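/- Let $\mathcal S$ be an operator system, realized on a Hilbert space $\mathcal H$ by a unital complete order embedding $\mathcal S\subseteq B(\mathcal H)$, and let $$\mathcal U(\mathcal S)=\left\{\begin{bmatrix}\lambda & x\\ 0&\lambda\end{bmatrix} : \lambda\in\mathbb C,\ x\in\mathcal S\right\}\subseteq B(\mathcal H^2),$$ a unital operator algebra which, up to completely isometric isomorphism, does not depend on the realization. Notation. For operator systems $\mathcal S,\mathcal T$, an element $X\in M_n(\mathcal S\otimes\mathcal T)$ is positive in $M_n(\mathcal S\otimes_{\min}\mathcal T)$ iff $(\varphi\otimes\psi)^{(n)}(X)\ge 0$ for all unital completely positive (ucp) maps $\varphi:\mathcal S\to M_k$, $\psi:\mathcal T\to M_m$ and all $k,m$; it is positive in $M_n(\mathcal S\otimes_{c}\mathcal T)$ iff $(\varphi\cdot\psi)^{(n)}(X)\ge0$ for all Hilbert spaces $\mathcal L$ and all ucp maps $\varphi:\mathcal S\to B(\mathcal L)$, $\psi:\mathcal T\to B(\mathcal L)$ with commuting ranges, where $(\varphi\cdot\psi)(s\otimes t)=\varphi(s)\psi(t)$. The equality $\mathcal S\otimes_{\min}\mathcal T=\mathcal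 S\otimes_c\mathcal T$ means that these matrix orders on $\mathcal S\otimes\mathcal T$ coincide. For operator algebras $\mathcal A\subseteq B(\mathcal H)$, $\mathcal B\subseteq B(\mathcal K)$, the matrix norms of $\mathcal A\otimes_{\min}\mathcal B$ are those inherited from $B(\mathcal H\otimes\mathcal K)$, and $\|X\|_{\max}=\sup\|(\pi\cdot\rho)^{(n)}(X)\|$ for $X\in M_n(\mathcal A\otimes\mathcal B)$, the supremum being over all Hilbert spaces $\mathcal L$ and all completely contractive representations $\pi:\mathcal A\to B(\mathcal L)$, $\rho:\mathcal B\to B(\mathcal L)$ with commuting ranges. The equality $\mathcal A\otimes_{\min}\mathcal B=\mathcal A\otimes_{\max}\mathcal B$ means that these norms agree on $M_n(\mathcal A\otimes\mathcal B)$ for every $n$; a C*-algebra is regarded as an operator algebra through any faithful representation. A C*-algebra $\mathcal D$ is nuclear if $\mathcal C\otimes_{\min}\mathcal D=\mathcal C\otimes_{\max}\mathcal D$ for every C*-algebra $\mathcal C$. The operator system $\mathcal S$ is a nuclearity detector if every unital C*-algebra $\mathcal D$ with $\mathcal S\otimes_{\min}\mathcal D=\mathcal S\otimes_{c}\mathcal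 D$ is nuclear; an operator algebra $\mathcal A$ is a nuclearity detector if every unital C*-algebra $\mathcal D$ with $\mathcal A\otimes_{\min}\mathcal D=\mathcal A\otimes_{\max}\mathcal D$ is nuclear. Claim. 1. For every unital C*-algebra $\mathcal D$, if $\mathcal U(\mathcal S)\otimes_{\min}\mathcal D=\mathcal U(\mathcal S)\otimes_{\max}\mathcal D$, then $\mathcal S\otimes_{\min}\mathcal D=\mathcal S\otimes_c\mathcal D$. 2. If $\mathcal S$ is a nuclearity detector, then $\mathcal U(\mathcal S)$ is a nuclearity detector. -/

import Mathlib

open scoped TensorProduct ENNReal ComplexOrder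

universe u

noncomputable section

/-! ### Operator systems -/

/-- For a scalar matrix `A` of size `n × m` and `X ∈ M_n(S)`, the matrix `A* X A ∈ M_m(S)`. -/
def scalarConj {S : Type u} [AddCommGroup S] [Module ℂ S] {n m : ℕ}
    (A : Matrix (Fin n) (Fin m) ℂ) (X : Matrix (Fin n) (Fin n) S) : Matrix (Fin m) (Fin m) S :=
  fun i j => ∑ k, ∑ l, (star (A k i) * A l j) • X k l

/-- An (abstract) operator system: a complex `*`-vector space with a matrix order
`pos n = M_n(S)_+` and an Archimedean matrix order unit `unit`. -/
class OperatorSystem (S : Type u) [AddCommGroup S] [Module ℂ S] [StarAddMonoid S]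
    [StarModule ℂ S] where
  /-- the order unit `1_S` -/
  unit : S
  /-- the cone `M_n(S)_+` -/
  pos : ∀ n : ℕ, Set (Matrix (Fin n) (Fin n) S)
  star_unit : star unit = unit
  isHermitian_of_mem : ∀ {n : ℕ} {X : Matrix (Fin n) (Fin n) S}, X ∈ pos n → X.IsHermitian
  zero_mem : ∀ n : ℕ, 0 ∈ pos n
  add_mem : ∀ {n : ℕ} {X Y : Matrix (Fin n) (Fin n) S}, X ∈ pos n → Y ∈ pos n → X + Y ∈ pos n
  smul_mem : ∀ {n : ℕ} {X : Matrix (Fin n) (Fin n) S} {r : ℝ}, 0 ≤ r → X ∈ pos n →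
    (r : ℂ) • X ∈ pos n
  eq_zero_of_mem_of_neg_mem : ∀ {n : ℕ} {X : Matrix (Fin n) (Fin n) S},
    X ∈ pos n → -X ∈ pos n → X = 0
  conj_mem : ∀ {n m : ℕ} (A : Matrix (Fin n) (Fin m) ℂ) {X : Matrix (Fin n) (Fin n) S},
    X ∈ pos n → scalarConj A X ∈ pos m
  order_unit : ∀ {n : ℕ} {X : Matrix (Fin n) (Fin n) S}, X.IsHermitian →
    ∃ r : ℝ, 0 < r ∧ (r : ℂ) • Matrix.diagonal (fun _ : Fin n => unit) + X ∈ pos n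
  archimedean : ∀ {n : ℕ} {X : Matrix (Fin n) (Fin n) S},
    (∀ r : ℝ, 0 < r → (r : ℂ) • Matrix.diagonal (fun _ : Fin n => unit) + X ∈ pos n) → X ∈ pos n

section CStar

variable {D : Type u} [CStarAlgebra D]

theorem nonneg_iff_exists_star_mul_self {A : Type u} [CStarAlgebra A] [PartialOrder A]
    [StarOrderedRing A] (a : A) : 0 ≤ a ↔ ∃ b : A, a = star b * b :=
  CStarAlgebra.nonneg_iff_eq_star_mul_self

theorem norm_add_one_smul_add_nonneg {A : Type u} [CStarAlgebra A] [PartialOrder A]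
    [StarOrderedRing A] {a : A} (ha : IsSelfAdjoint a) :
    0 ≤ ((‖a‖ + 1 : ℝ) : ℂ) • (1 : A) + a := by
  have h : ((‖a‖ + 1 : ℝ) : ℂ) • (1 : A) + a = 1 + (algebraMap ℝ A ‖a‖ + a) := by
    rw [Algebra.algebraMap_eq_smul_one, Complex.coe_smul, add_smul, one_smul]
    abel
  have h2 := ha.neg_algebraMap_norm_le_self
  rw [neg_le_iff_add_nonneg'] at h2
  rw [h]
  exact add_nonneg zero_le_one h2

theorem exists_gram_iff_nonneg [PartialOrder D] [StarOrderedRing D] {n : ℕ}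
    (X : Matrix (Fin n) (Fin n) D) :
    (∃ Y : Matrix (Fin n) (Fin n) D, X = Y.conjTranspose * Y) ↔
      0 ≤ (CStarMatrix.ofMatrix X : CStarMatrix (Fin n) (Fin n) D) := by
  exact (nonneg_iff_exists_star_mul_self
    (CStarMatrix.ofMatrix X : CStarMatrix (Fin n) (Fin n) D)).symm

theorem conjTranspose_mul_self_nonneg_rect [PartialOrder D] [StarOrderedRing D] {n m : ℕ}
    (Z : Matrix (Fin n) (Fin m) D) :
    0 ≤ (CStarMatrix.ofMatrix (Z.conjTranspose * Z) : CStarMatrix (Fin m) (Fin m) D) := by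
  rcases m with _ | m
  · exact le_of_eq (CStarMatrix.ext fun i => i.elim0)
  · let R : Fin n → CStarMatrix (Fin (m + 1)) (Fin (m + 1)) D := fun k =>
      CStarMatrix.ofMatrix (fun i j => if i = 0 then Z k j else 0)
    have h : (CStarMatrix.ofMatrix (Z.conjTranspose * Z) :
        CStarMatrix (Fin (m + 1)) (Fin (m + 1)) D) = ∑ k, star (R k) * R k := by
      have key : (Z.conjTranspose * Z) =
          ∑ k, (CStarMatrix.ofMatrix.symm (star (R k) * R k) :
            Matrix (Fin (m + 1)) (Fin (m + 1)) D) := by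
        ext i j
        rw [Matrix.sum_apply, Matrix.mul_apply]
        refine Finset.sum_congr rfl fun k _ => ?_
        rw [CStarMatrix.ofMatrix_symm_apply, CStarMatrix.mul_apply,
          Finset.sum_eq_single (0 : Fin (m + 1))]
        · rw [CStarMatrix.star_apply]
          have : ∀ q, R k 0 q = Z k q := fun q => rfl
          rw [this, this, Matrix.conjTranspose_apply]
        · intro b _ hb
          have : R k b j = 0 := if_neg hb
          rw [this, mul_zero]
        · simp
      exact key
    rw [h]
    exact Finset.sum_nonneg fun k _ => star_mul_self_nonneg _

/-- A unital C⋆-algebra `D` is an operator system: `M_n(D)_+` is the set of elements `Y* Y` of the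
C⋆-algebra `M_n(D)`. -/
instance CStarAlgebra.instOperatorSystem : OperatorSystem D where
  unit := 1
  pos n := {X | ∃ Y : Matrix (Fin n) (Fin n) D, X = Y.conjTranspose * Y}
  star_unit := star_one D
  isHermitian_of_mem := by
    rintro n X ⟨Y, rfl⟩
    exact Matrix.isHermitian_conjTranspose_mul_self Y
  zero_mem n := ⟨0, by simp⟩
  add_mem := by
    intro n X Y hX hY
    let _ := CStarAlgebra.spectralOrder D
    have _ := CStarAlgebra.spectralOrderedRing D
    exact (exists_gram_iff_nonneg _).2
      (add_nonneg ((exists_gram_iff_nonneg _).1 hX) ((exists_gram_iff_nonneg _).1 hY))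
  smul_mem := by
    rintro n X r hr ⟨Y, rfl⟩
    refine ⟨((Real.sqrt r : ℝ) : ℂ) • Y, ?_⟩
    rw [Matrix.conjTranspose_smul, Matrix.smul_mul, Matrix.mul_smul, smul_smul]
    congr 1
    rw [RCLike.star_def, Complex.conj_ofReal, ← Complex.ofReal_mul, Real.mul_self_sqrt hr]
  eq_zero_of_mem_of_neg_mem := by
    intro n X hX hX'
    let _ := CStarAlgebra.spectralOrder D
    have _ := CStarAlgebra.spectralOrderedRing D
    have h1 := (exists_gram_iff_nonneg _).1 hX
    have h2 : 0 ≤ -(CStarMatrix.ofMatrix X : CStarMatrix (Fin n) (Fin n) D) :=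
      (exists_gram_iff_nonneg _).1 hX'
    have h3 : (CStarMatrix.ofMatrix X : CStarMatrix (Fin n) (Fin n) D) = 0 :=
      le_antisymm (neg_nonneg.1 h2) h1
    exact h3
  conj_mem := by
    rintro n m A X ⟨Y, rfl⟩
    let _ := CStarAlgebra.spectralOrder D
    have _ := CStarAlgebra.spectralOrderedRing D
    let Z : Matrix (Fin n) (Fin m) D := fun i j => ∑ l, A l j • Y i l
    have h : scalarConj A (Y.conjTranspose * Y) = Z.conjTranspose * Z := by
      ext i j
      have e : ∀ p, star (Z p i) * Z p j =
          ∑ k, ∑ l, (star (A k i) * A l j) • (star (Y p k) * Y p l) := by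
        intro p
        simp only [Z, star_sum, star_smul, Finset.sum_mul_sum, smul_mul_smul_comm]
      rw [Matrix.mul_apply]
      simp only [Matrix.conjTranspose_apply, e]
      rw [Finset.sum_comm]
      refine Finset.sum_congr rfl fun k _ => ?_
      rw [Finset.sum_comm]
      refine Finset.sum_congr rfl fun l _ => ?_
      rw [Matrix.mul_apply, Finset.smul_sum]
      rfl
    rw [h]
    exact (exists_gram_iff_nonneg _).2 (conjTranspose_mul_self_nonneg_rect Z)
  order_unit := by
    intro n X hX
    let _ := CStarAlgebra.spectralOrder D
    have _ := CStarAlgebra.spectralOrderedRing D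
    let M : CStarMatrix (Fin n) (Fin n) D := CStarMatrix.ofMatrix X
    have hM : IsSelfAdjoint M := hX
    refine ⟨‖M‖ + 1, by positivity, (exists_gram_iff_nonneg _).2 ?_⟩
    exact norm_add_one_smul_add_nonneg hM
  archimedean := by
    intro n X hX
    let _ := CStarAlgebra.spectralOrder D
    have _ := CStarAlgebra.spectralOrderedRing D
    refine (exists_gram_iff_nonneg _).2 ?_
    let M : CStarMatrix (Fin n) (Fin n) D := CStarMatrix.ofMatrix X
    have h1 : ∀ r : ℝ, 0 < r → 0 ≤ (r : ℂ) • (1 : CStarMatrix (Fin n) (Fin n) D) + M :=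
      fun r hr => (exists_gram_iff_nonneg _).1 (hX r hr)
    have h2 : Filter.Tendsto (fun r : ℝ => (r : ℂ) • (1 : CStarMatrix (Fin n) (Fin n) D) + M)
        (nhdsWithin 0 (Set.Ioi 0)) (nhds M) := by
      have : Continuous (fun r : ℝ => (r : ℂ) • (1 : CStarMatrix (Fin n) (Fin n) D) + M) := by
        fun_prop
      have h3 := (this.tendsto 0).mono_left (nhdsWithin_le_nhds (s := Set.Ioi 0))
      simpa using h3
    exact ge_of_tendsto h2 (Filter.eventually_of_mem self_mem_nhdsWithin fun r hr => h1 r hr)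

end CStar

/-! ### Matrices of operators and unital completely positive maps -/

section Operators

variable {H K : Type u} [NormedAddCommGroup H] [InnerProductSpace ℂ H]
  [NormedAddCommGroup K] [InnerProductSpace ℂ K]

/-- The identification `M_n(B(H)) = B(H^n)`, where `H^n` is the Hilbert sum of `n` copies
of `H`. -/
def matOp {n : ℕ} (M : Matrix (Fin n) (Fin n) (H →L[ℂ] H)) :
    PiLp 2 (fun _ : Fin n => H) →L[ℂ] PiLp 2 (fun _ : Fin n => H) :=
  ((PiLp.continuousLinearEquiv 2 ℂ (fun _ : Fin n => H)).symm :
      (Fin n → H) →L[ℂ] PiLp 2 (fun _ : Fin n => H)) ∘L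
    ContinuousLinearMap.pi fun i => ∑ j, M i j ∘L PiLp.proj 2 (fun _ : Fin n => H) j

theorem matOp_apply {n : ℕ} (M : Matrix (Fin n) (Fin n) (H →L[ℂ] H))
    (v : PiLp 2 (fun _ : Fin n => H)) (i : Fin n) : matOp M v i = ∑ j, M i j (v j) := by
  simp [matOp]

variable {S T : Type u} [AddCommGroup S] [Module ℂ S] [StarAddMonoid S] [StarModule ℂ S]
  [OperatorSystem S] [AddCommGroup T] [Module ℂ T] [StarAddMonoid T] [StarModule ℂ T]
  [OperatorSystem T]

/-- `φ : S → B(H)` is unital and completely positive. -/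
def IsUCP (φ : S →ₗ[ℂ] (H →L[ℂ] H)) : Prop :=
  φ OperatorSystem.unit = 1 ∧
    ∀ (n : ℕ) (X : Matrix (Fin n) (Fin n) S), X ∈ OperatorSystem.pos n →
      (matOp (X.map φ)).IsPositive

/-- `φ : S → M_k` is unital and completely positive; `M_n(M_k)` is identified with `M_{nk}`. -/
def IsMatrixUCP {k : ℕ} (φ : S →ₗ[ℂ] Matrix (Fin k) (Fin k) ℂ) : Prop :=
  φ OperatorSystem.unit = 1 ∧
    ∀ (n : ℕ) (X : Matrix (Fin n) (Fin n) S), X ∈ OperatorSystem.pos n →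
      (Matrix.comp _ _ _ _ _ (X.map φ)).PosSemidef

/-- `ι : S → B(H)` is a unital complete order embedding, that is, it realizes the abstract operator
system `S` as a concrete operator system on `H`. -/
def IsCompleteOrderEmbedding (ι : S →ₗ[ℂ] (H →L[ℂ] H)) : Prop :=
  ι OperatorSystem.unit = 1 ∧
    ∀ (n : ℕ) (X : Matrix (Fin n) (Fin n) S),
      X ∈ OperatorSystem.pos n ↔ (matOp (X.map ι)).IsPositive

/-- `φ ⊗ ψ : S ⊗ T → M_k ⊗ M_m = M_{km}`. -/
def kronMap {V W : Type u} [AddCommGroup V] [Module ℂ V] [AddCommGroup W] [Module ℂ W] {k m : ℕ}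
    (φ : V →ₗ[ℂ] Matrix (Fin k) (Fin k) ℂ) (ψ : W →ₗ[ℂ] Matrix (Fin m) (Fin m) ℂ) :
    V ⊗[ℂ] W →ₗ[ℂ] Matrix (Fin k × Fin m) (Fin k × Fin m) ℂ :=
  TensorProduct.lift (Matrix.kroneckerBilinear.compl₁₂ φ ψ)

/-- `φ · ψ : V ⊗ W → B(H)`, `v ⊗ w ↦ φ(v) ψ(w)`. -/
def dotMap {V W : Type u} [AddCommGroup V] [Module ℂ V] [AddCommGroup W] [Module ℂ W]
    (φ : V →ₗ[ℂ] (H →L[ℂ] H)) (ψ : W →ₗ[ℂ] (H →L[ℂ] H)) : V ⊗[ℂ] W →ₗ[ℂ] (H →L[ℂ] H) :=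
  TensorProduct.lift ((LinearMap.mul ℂ (H →L[ℂ] H)).compl₁₂ φ ψ)

/-- The Hilbert space tensor product of `H` and `K`. -/
abbrev HilbertTensor (H K : Type u) [NormedAddCommGroup H] [InnerProductSpace ℂ H]
    [NormedAddCommGroup K] [InnerProductSpace ℂ K] : Type u :=
  UniformSpace.Completion (H ⊗[ℂ] K)

theorem completion_add {E : Type u} [NormedAddCommGroup E] [NormedSpace ℂ E] (f g : E →L[ℂ] E) :
    (f + g).completion = f.completion + g.completion := by
  ext x
  induction x using UniformSpace.Completion.induction_on with
  | hp => exact isClosed_eq (ContinuousLinearMap.continuous _) (ContinuousLinearMap.continuous _)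
  | ih x => simp [UniformSpace.Completion.coe_add]

theorem completion_smul {E : Type u} [NormedAddCommGroup E] [NormedSpace ℂ E] (c : ℂ)
    (f : E →L[ℂ] E) : (c • f).completion = c • f.completion := by
  ext x
  induction x using UniformSpace.Completion.induction_on with
  | hp => exact isClosed_eq (ContinuousLinearMap.continuous _) (ContinuousLinearMap.continuous _)
  | ih x => simp

/-- The bilinear map `B(H) × B(K) → B(H ⊗ K)`, `(a, b) ↦ a ⊗ b`. -/
def opTensor (H K : Type u) [NormedAddCommGroup H] [InnerProductSpace ℂ H]
    [NormedAddCommGroup K] [InnerProductSpace ℂ K] :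
    (H →L[ℂ] H) →ₗ[ℂ] (K →L[ℂ] K) →ₗ[ℂ] (HilbertTensor H K →L[ℂ] HilbertTensor H K) :=
  LinearMap.mk₂ ℂ (fun a b => (TensorProduct.mapL a b).completion)
    (fun a a' b => by rw [TensorProduct.mapL_add_left, completion_add])
    (fun c a b => by rw [TensorProduct.mapL_smul_left, completion_smul])
    (fun a b b' => by rw [TensorProduct.mapL_add_right, completion_add])
    (fun c a b => by rw [TensorProduct.mapL_smul_right, completion_smul])

/-- `φ ⊗ ψ : V ⊗ W → B(H ⊗ K)`. -/
def spatialMap {V W : Type u} [AddCommGroup V] [Module ℂ V] [AddCommGroup W] [Module ℂ W]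
    (φ : V →ₗ[ℂ] (H →L[ℂ] H)) (ψ : W →ₗ[ℂ] (K →L[ℂ] K)) :
    V ⊗[ℂ] W →ₗ[ℂ] (HilbertTensor H K →L[ℂ] HilbertTensor H K) :=
  TensorProduct.lift ((opTensor H K).compl₁₂ φ ψ)

end Operators

/-! ### Operator system tensor products -/

section SystemTensor

variable (S T : Type u) [AddCommGroup S] [Module ℂ S] [StarAddMonoid S] [StarModule ℂ S]
  [OperatorSystem S] [AddCommGroup T] [Module ℂ T] [StarAddMonoid T] [StarModule ℂ T]
  [OperatorSystem T]

/-- The positive cone of `M_n(S ⊗_min T)`. -/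
def minCone (n : ℕ) : Set (Matrix (Fin n) (Fin n) (S ⊗[ℂ] T)) :=
  {X | ∀ (k m : ℕ) (φ : S →ₗ[ℂ] Matrix (Fin k) (Fin k) ℂ)
    (ψ : T →ₗ[ℂ] Matrix (Fin m) (Fin m) ℂ), IsMatrixUCP φ → IsMatrixUCP ψ →
      (Matrix.comp _ _ _ _ _ (X.map (kronMap φ ψ))).PosSemidef}

/-- The positive cone of `M_n(S ⊗_c T)`. -/
def commCone (n : ℕ) : Set (Matrix (Fin n) (Fin n) (S ⊗[ℂ] T)) :=
  {X | ∀ (H : Type u) [NormedAddCommGroup H] [InnerProductSpace ℂ H] [CompleteSpace H]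
    (φ : S →ₗ[ℂ] (H →L[ℂ] H)) (ψ : T →ₗ[ℂ] (H →L[ℂ] H)), IsUCP φ → IsUCP ψ →
      (∀ s t, Commute (φ s) (ψ t)) → (matOp (X.map (dotMap φ ψ))).IsPositive}

/-- `S ⊗_min T = S ⊗_c T` as operator systems: the two matrix orders on the algebraic tensor
product coincide. -/
def SystemMinEqComm : Prop := ∀ n : ℕ, minCone S T n = commCone S T n

end SystemTensor

/-! ### Operator algebra tensor products -/

section AlgebraTensor

variable {A B : Type u} [Ring A] [Algebra ℂ A] [Ring B] [Algebra ℂ B]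
  {H K : Type u} [NormedAddCommGroup H] [InnerProductSpace ℂ H]
  [NormedAddCommGroup K] [InnerProductSpace ℂ K]

/-- `π : A → B(L)` is completely contractive, where `A` carries the matrix norms of `B(H)` through
`j : A → B(H)`. -/
def IsCompletelyContractive {L : Type u} [NormedAddCommGroup L] [InnerProductSpace ℂ L]
    (j : A →ₐ[ℂ] (H →L[ℂ] H)) (π : A →ₙₐ[ℂ] (L →L[ℂ] L)) : Prop :=
  ∀ (n : ℕ) (X : Matrix (Fin n) (Fin n) A), ‖matOp (X.map π)‖ ≤ ‖matOp (X.map j)‖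

/-- The norm of `M_n(A ⊗_min B)` on `M_n(A ⊗ B)` for operator algebras `j : A ⊆ B(H)` and
`k : B ⊆ B(K)`: the one inherited from `B(H ⊗ K)`. -/
def algMinNorm (j : A →ₐ[ℂ] (H →L[ℂ] H)) (k : B →ₐ[ℂ] (K →L[ℂ] K)) {n : ℕ}
    (X : Matrix (Fin n) (Fin n) (A ⊗[ℂ] B)) : ℝ≥0∞ :=
  ‖matOp (X.map (spatialMap j.toLinearMap k.toLinearMap))‖ₑ

/-- The norm of `M_n(A ⊗_max B)` on `M_n(A ⊗ B)` for operator algebras `j : A ⊆ B(H)` and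
`k : B ⊆ B(K)`: the supremum over all pairs of completely contractive representations with
commuting ranges. -/
def algMaxNorm (j : A →ₐ[ℂ] (H →L[ℂ] H)) (k : B →ₐ[ℂ] (K →L[ℂ] K)) {n : ℕ}
    (X : Matrix (Fin n) (Fin n) (A ⊗[ℂ] B)) : ℝ≥0∞ :=
  sSup {r | ∃ (L : Type u) (_ : NormedAddCommGroup L) (_ : InnerProductSpace ℂ L)
    (_ : CompleteSpace L) (π : A →ₙₐ[ℂ] (L →L[ℂ] L)) (ρ : B →ₙₐ[ℂ] (L →L[ℂ] L)),
      IsCompletelyContractive j π ∧ IsCompletelyContractive k ρ ∧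
      (∀ a b, Commute (π a) (ρ b)) ∧
      r = ‖matOp (X.map (dotMap (π : A →ₗ[ℂ] (L →L[ℂ] L)) (ρ : B →ₗ[ℂ] (L →L[ℂ] L))))‖ₑ}

/-- `A ⊗_min D = A ⊗_max D` completely isometrically, for an operator algebra `A ⊆ B(H)` and a
unital C⋆-algebra `D`, which is regarded as an operator algebra through a faithful
representation (neither norm depends on which one). -/
def AlgebraMinEqMax (A : Subalgebra ℂ (H →L[ℂ] H)) (D : Type u) [CStarAlgebra D] : Prop :=
  ∃ (K : Type u) (_ : NormedAddCommGroup K) (_ : InnerProductSpace ℂ K) (_ : CompleteSpace K)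
    (ρ : D →⋆ₐ[ℂ] (K →L[ℂ] K)), Function.Injective ρ ∧
      ∀ (n : ℕ) (X : Matrix (Fin n) (Fin n) (A ⊗[ℂ] D)),
        algMinNorm A.val ρ.toAlgHom X = algMaxNorm A.val ρ.toAlgHom X

end AlgebraTensor

/-! ### Nuclearity and its detectors -/

/-- The maximal C⋆-norm on `C ⊗ D`. -/
def cstarMaxNorm {C D : Type u} [NonUnitalCStarAlgebra C] [NonUnitalCStarAlgebra D]
    (x : C ⊗[ℂ] D) : ℝ≥0∞ :=
  sSup {r | ∃ (L : Type u) (_ : NormedAddCommGroup L) (_ : InnerProductSpace ℂ L)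
    (_ : CompleteSpace L) (σ : C →⋆ₙₐ[ℂ] (L →L[ℂ] L)) (τ : D →⋆ₙₐ[ℂ] (L →L[ℂ] L)),
      (∀ c d, Commute (σ c) (τ d)) ∧
      r = ‖dotMap (σ : C →ₗ[ℂ] (L →L[ℂ] L)) (τ : D →ₗ[ℂ] (L →L[ℂ] L)) x‖ₑ}

/-- A C⋆-algebra `D` is nuclear if `C ⊗_min D = C ⊗_max D` for every C⋆-algebra `C`, where the
minimal (spatial) norm is computed in faithful representations. -/
def IsNuclear (D : Type u) [NonUnitalCStarAlgebra D] : Prop :=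
  ∀ (C : Type u) [NonUnitalCStarAlgebra C] (H K : Type u)
    [NormedAddCommGroup H] [InnerProductSpace ℂ H] [CompleteSpace H]
    [NormedAddCommGroup K] [InnerProductSpace ℂ K] [CompleteSpace K]
    (σ : C →⋆ₙₐ[ℂ] (H →L[ℂ] H)) (τ : D →⋆ₙₐ[ℂ] (K →L[ℂ] K)),
    Function.Injective σ → Function.Injective τ → ∀ x : C ⊗[ℂ] D,
      ‖spatialMap (σ : C →ₗ[ℂ] (H →L[ℂ] H)) (τ : D →ₗ[ℂ] (K →L[ℂ] K)) x‖ₑ = cstarMaxNorm x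

/-- The operator system `S` is a nuclearity detector. -/
def SystemDetectsNuclearity (S : Type u) [AddCommGroup S] [Module ℂ S] [StarAddMonoid S]
    [StarModule ℂ S] [OperatorSystem S] : Prop :=
  ∀ (D : Type u) [CStarAlgebra D], SystemMinEqComm S D → IsNuclear D

/-- The operator algebra `A ⊆ B(H)` is a nuclearity detector. -/
def AlgebraDetectsNuclearity {H : Type u} [NormedAddCommGroup H] [InnerProductSpace ℂ H]
    (A : Subalgebra ℂ (H →L[ℂ] H)) : Prop :=
  ∀ (D : Type u) [CStarAlgebra D], AlgebraMinEqMax A D → IsNuclear D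

/-! ### The operator algebra `U(X)` -/

/-- The upper triangular operator `[[c, x], [0, c]]` on `H²`. -/
def upperOp {H : Type u} [NormedAddCommGroup H] [InnerProductSpace ℂ H] (c : ℂ) (x : H →L[ℂ] H) :
    PiLp 2 (fun _ : Fin 2 => H) →L[ℂ] PiLp 2 (fun _ : Fin 2 => H) :=
  matOp !![c • 1, x; 0, c • 1]

/-- `U(X) ⊆ B(H²)` for a subspace `X` of `B(H)`: all `[[c, x], [0, c]]` with `c ∈ ℂ`, `x ∈ X`. -/
def upperAlgebra {H : Type u} [NormedAddCommGroup H] [InnerProductSpace ℂ H]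
    (X : Submodule ℂ (H →L[ℂ] H)) :
    Subalgebra ℂ (PiLp 2 (fun _ : Fin 2 => H) →L[ℂ] PiLp 2 (fun _ : Fin 2 => H)) where
  carrier := {T | ∃ c : ℂ, ∃ x ∈ X, T = upperOp c x}
  mul_mem' := by
    rintro _ _ ⟨c, x, hx, rfl⟩ ⟨d, y, hy, rfl⟩
    refine ⟨c * d, c • y + d • x, X.add_mem (X.smul_mem _ hy) (X.smul_mem _ hx), ?_⟩
    ext v i
    fin_cases i <;> simp [upperOp, matOp_apply, Fin.sum_univ_two, mul_smul, smul_comm d c]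
    abel
  add_mem' := by
    rintro _ _ ⟨c, x, hx, rfl⟩ ⟨d, y, hy, rfl⟩
    refine ⟨c + d, x + y, X.add_mem hx hy, ?_⟩
    ext v i
    fin_cases i <;> simp [upperOp, matOp_apply, Fin.sum_univ_two, add_smul]
    abel
  algebraMap_mem' c := by
    refine ⟨c, 0, X.zero_mem, ?_⟩
    ext v i
    fin_cases i <;> simp [upperOp, matOp_apply, Fin.sum_univ_two, Algebra.algebraMap_eq_smul_one]

end

/-! The commuting cone always lies in the minimal cone, because ucp maps into `M_k` and `M_m` give
commuting ucp maps `φ ⊗ 1` and `1 ⊗ ψ` on one Hilbert space (`commCone_subset_minCone`). The content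
is the reverse inclusion, obtained by turning commuting ucp maps into commuting representations of
`U(S)` and `D`.

Let `φ : S → B(L)` and `ψ : D → B(L)` be ucp with commuting ranges. The map `ψ` need not be
multiplicative, so it is dilated by Stinespring to a representation `π` of `D` on the completion of
`D ⊗ L`. Since `φ` takes values in the commutant of `ψ`, the operators `d ⊗ ξ ↦ d ⊗ φ(s) ξ` are
bounded there. They define a unital map `φ'` commuting with `π`, and `φ · ψ` is a compression of `φ'
· π`. The lift satisfies the same matrix norm bounds as `φ` (`norm_matOp_dilationLift_le`), and `φ`
is completely contractive because it is ucp (`IsUCP.norm_matOp_map_le`).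

Products in `U(S)` never multiply two elements of `S`, so any unital linear map on `S` induces a
homomorphism of `U(S)`; it is completely contractive when the map is, being the restriction of an
amplification to `M_2(S)` (`isCompletelyContractive_upperRep`). Thus `φ'` gives a representation of
`U(S)` commuting with `π ⊕ π`. Evaluating the equality of the tensor norms on the `(0,1)` corner
yields `‖(φ · ψ)(X)‖ ≤ ‖(ι ⊗ ρ)(X)‖` at every matrix level (`norm_matOp_dotMap_le`).

Finally norms are converted back into order. Both maps are unital, so the inequality holds for `X +
z 1` with any scalar `z`, and domination of all these shifted norms transfers positivity
(`isPositive_of_norm_add_smul_one_le`). Elements of the minimal cone are positive in `ι ⊗ ρ` by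
compression to finite-dimensional subspaces. The statement on detectors follows by composing
implications. -/

noncomputable section

/-! ### Matrices of operators -/

section MatOp

variable {H K : Type u} [NormedAddCommGroup H] [InnerProductSpace ℂ H]
  [NormedAddCommGroup K] [InnerProductSpace ℂ K] {n : ℕ}

/-- The inequality is in the order of `ℂ`, so it also says that the sum is real; over `ℂ` this
already forces symmetry, and no separate self-adjointness clause is needed. -/
theorem matOp_isPositive_iff (M : Matrix (Fin n) (Fin n) (H →L[ℂ] H)) :
    (matOp M).IsPositive ↔ ∀ v : Fin n → H, 0 ≤ ∑ i, ∑ j, inner ℂ (v i) (M i j (v j)) := by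
  have key : ∀ v : PiLp 2 (fun _ : Fin n => H),
      inner ℂ v (matOp M v) = ∑ i, ∑ j, inner ℂ (v i) (M i j (v j)) := by
    intro v
    simp [PiLp.inner_apply, matOp_apply, inner_sum]
  have h2 : ∀ v : PiLp 2 (fun _ : Fin n => H),
      ((RCLike.re (inner ℂ (matOp M v) v) : ℂ) = inner ℂ (matOp M v) v ∧
        0 ≤ RCLike.re (inner ℂ (matOp M v) v)) ↔
      0 ≤ ∑ i, ∑ j, inner ℂ (v i) (M i j (v j)) := by
    intro v
    rw [← key, ← inner_conj_symm v (matOp M v), Complex.le_def]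
    generalize inner ℂ (matOp M v) v = w
    simp only [Complex.ext_iff, and_comm]
    simpa using fun _ => eq_comm
  rw [ContinuousLinearMap.isPositive_iff_complex]
  constructor
  · intro h v
    exact (h2 (WithLp.toLp 2 v)).1 (h _)
  · intro h v
    exact (h2 v).2 (h v)

theorem norm_matOp_le_iff (M : Matrix (Fin n) (Fin n) (H →L[ℂ] H)) {C : ℝ} (hC : 0 ≤ C) :
    ‖matOp M‖ ≤ C ↔
      ∀ v : Fin n → H, ∑ i, ‖∑ j, M i j (v j)‖ ^ 2 ≤ C ^ 2 * ∑ j, ‖v j‖ ^ 2 := by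
  have key : ∀ v : PiLp 2 (fun _ : Fin n => H), ‖matOp M v‖ ≤ C * ‖v‖ ↔
      ∑ i, ‖∑ j, M i j (v j)‖ ^ 2 ≤ C ^ 2 * ∑ j, ‖v j‖ ^ 2 := by
    intro v
    rw [← sq_le_sq₀ (norm_nonneg _) (by positivity), mul_pow, PiLp.norm_sq_eq_of_L2,
      PiLp.norm_sq_eq_of_L2]
    simp [matOp_apply]
  rw [ContinuousLinearMap.opNorm_le_iff hC]
  exact ⟨fun h v => (key (WithLp.toLp 2 v)).1 (h _), fun h v => (key v).2 (h v)⟩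

theorem sum_norm_sq_le_norm_matOp (M : Matrix (Fin n) (Fin n) (H →L[ℂ] H)) (v : Fin n → H) :
    ∑ i, ‖∑ j, M i j (v j)‖ ^ 2 ≤ ‖matOp M‖ ^ 2 * ∑ j, ‖v j‖ ^ 2 :=
  (norm_matOp_le_iff M (ContinuousLinearMap.opNorm_nonneg _)).1 le_rfl v

/-- Compressing all entries of a matrix of operators by two contractions does not increase the
norm. -/
theorem norm_matOp_conj_le {H' : Type u} [NormedAddCommGroup H'] [InnerProductSpace ℂ H']
    (a : H →L[ℂ] H') (b : H' →L[ℂ] H) (ha : ‖a‖ ≤ 1) (hb : ‖b‖ ≤ 1)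
    (M : Matrix (Fin n) (Fin n) (H →L[ℂ] H)) :
    ‖matOp (M.map fun T => a ∘L T ∘L b)‖ ≤ ‖matOp M‖ := by
  rw [norm_matOp_le_iff _ (ContinuousLinearMap.opNorm_nonneg _)]
  intro v
  calc ∑ i, ‖∑ j, (M.map fun T => a ∘L T ∘L b) i j (v j)‖ ^ 2
      = ∑ i, ‖a (∑ j, M i j (b (v j)))‖ ^ 2 := by simp
    _ ≤ ∑ i, ‖∑ j, M i j (b (v j))‖ ^ 2 := by
        gcongr with i
        exact (a.le_of_opNorm_le ha _).trans (one_mul _).le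
    _ ≤ ‖matOp M‖ ^ 2 * ∑ j, ‖b (v j)‖ ^ 2 := sum_norm_sq_le_norm_matOp M _
    _ ≤ ‖matOp M‖ ^ 2 * ∑ j, ‖v j‖ ^ 2 := by
        gcongr with i
        exact (b.le_of_opNorm_le hb _).trans (one_mul _).le

theorem matOp_add (M N : Matrix (Fin n) (Fin n) (H →L[ℂ] H)) :
    matOp (M + N) = matOp M + matOp N := by
  ext v i
  simp [matOp_apply, Finset.sum_add_distrib]

theorem matOp_smul (c : ℂ) (M : Matrix (Fin n) (Fin n) (H →L[ℂ] H)) :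
    matOp (c • M) = c • matOp M := by
  ext v i
  simp [matOp_apply, Finset.smul_sum]

theorem matOp_one : matOp (1 : Matrix (Fin n) (Fin n) (H →L[ℂ] H)) = 1 := by
  ext v i
  have : ∀ j, (1 : Matrix (Fin n) (Fin n) (H →L[ℂ] H)) i j (v j) = if i = j then v j else 0 := by
    intro j
    rw [Matrix.one_apply]
    split_ifs <;> simp
  simp [matOp_apply, this]

theorem matOp_mul (M N : Matrix (Fin n) (Fin n) (H →L[ℂ] H)) :
    matOp (M * N) = matOp M * matOp N := by
  ext v i
  simp only [matOp_apply, Matrix.mul_apply, _root_.sum_apply,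
    mul_apply_eq_comp, map_sum]
  exact Finset.sum_comm

theorem matOp_conjTranspose [CompleteSpace H] (M : Matrix (Fin n) (Fin n) (H →L[ℂ] H)) :
    matOp M.conjTranspose = star (matOp M) := by
  rw [ContinuousLinearMap.star_eq_adjoint, ContinuousLinearMap.eq_adjoint_iff]
  intro v w
  simp only [PiLp.inner_apply, matOp_apply, sum_inner, inner_sum, Matrix.conjTranspose_apply,
    ContinuousLinearMap.star_eq_adjoint, ContinuousLinearMap.adjoint_inner_left]
  exact Finset.sum_comm

theorem matOp_injective {n : ℕ} :
    Function.Injective (matOp : Matrix (Fin n) (Fin n) (H →L[ℂ] H) → _) := by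
  intro M N h
  ext i j x
  have h1 := congrArg (fun T => T (PiLp.single 2 j x) i) h
  simpa [matOp_apply, Pi.single_apply, apply_ite] using h1

/-- If `A` is positive and `‖T + z‖ ≤ ‖A + z‖` for all scalars `z`, then `T` is positive. -/
theorem isPositive_of_norm_add_smul_one_le {A : H →L[ℂ] H} {T : K →L[ℂ] K} (hA : A.IsPositive)
    (h : ∀ z : ℂ, ‖T + z • 1‖ ≤ ‖A + z • 1‖) : T.IsPositive := by
  -- For `z` in the left half-plane the cross term `2 Re ⟨A v, z v⟩` is nonpositive, so the bound
  -- has no term linear in `‖z‖`.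
  have hA' : ∀ z : ℂ, z.re ≤ 0 → ‖A + z • 1‖ ^ 2 ≤ ‖A‖ ^ 2 + ‖z‖ ^ 2 := by
    intro z hz
    have : ‖A + z • 1‖ ≤ √(‖A‖ ^ 2 + ‖z‖ ^ 2) := by
      refine ContinuousLinearMap.opNorm_le_bound _ (Real.sqrt_nonneg _) fun v => ?_
      rw [← sq_le_sq₀ (norm_nonneg _) (by positivity), mul_pow, Real.sq_sqrt (by positivity)]
      have hv := (ContinuousLinearMap.isPositive_iff_complex A).1 hA v
      have h1 : ‖A v‖ ^ 2 ≤ ‖A‖ ^ 2 * ‖v‖ ^ 2 := by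
        rw [← mul_pow]
        exact pow_le_pow_left₀ (norm_nonneg _) (A.le_opNorm v) 2
      have h2 : RCLike.re (inner ℂ (A v) (z • v)) ≤ 0 := by
        rw [inner_smul_right, ← hv.1]
        simpa using mul_nonpos_of_nonpos_of_nonneg hz hv.2
      have h3 := norm_add_sq (𝕜 := ℂ) (A v) (z • v)
      rw [norm_smul, mul_pow] at h3
      have h4 : (A + z • 1) v = A v + z • v := by simp
      rw [h4, h3]
      nlinarith
    calc ‖A + z • 1‖ ^ 2 ≤ √(‖A‖ ^ 2 + ‖z‖ ^ 2) ^ 2 := by gcongr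
      _ = _ := Real.sq_sqrt (by positivity)
  -- Along the ray `t z` the terms quadratic in `t` cancel on the two sides, so `2 t Re (z ⟨T x,
  -- x⟩)` stays bounded as `t → ∞` and its coefficient cannot be positive.
  have key : ∀ (x : K) (z : ℂ), z.re ≤ 0 → 0 ≤ -(z * inner ℂ (T x) x).re := by
    intro x z hz
    by_contra! hneg
    have hpos : 0 < (z * inner ℂ (T x) x).re := by linarith
    have bound : ∀ t : ℝ, 0 ≤ t →
        2 * t * (z * inner ℂ (T x) x).re ≤ ‖A‖ ^ 2 * ‖x‖ ^ 2 := by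
      intro t ht
      have hz' : ((t : ℂ) * z).re ≤ 0 := by simpa using mul_nonpos_of_nonneg_of_nonpos ht hz
      have h1 : ‖T x + ((t : ℂ) * z) • x‖ ^ 2 ≤ (‖A‖ ^ 2 + ‖(t : ℂ) * z‖ ^ 2) * ‖x‖ ^ 2 := by
        have e : T x + ((t : ℂ) * z) • x = (T + ((t : ℂ) * z) • 1) x := by simp
        rw [e]
        calc _ ≤ (‖T + ((t : ℂ) * z) • 1‖ * ‖x‖) ^ 2 := by
              gcongr
              exact ContinuousLinearMap.le_opNorm _ _
          _ ≤ (‖A + ((t : ℂ) * z) • 1‖ * ‖x‖) ^ 2 := by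
              gcongr
              exact h _
          _ ≤ _ := by
              rw [mul_pow]
              gcongr
              exact hA' _ hz'
      have h2 := norm_add_sq (𝕜 := ℂ) (T x) (((t : ℂ) * z) • x)
      rw [norm_smul, mul_pow, inner_smul_right, mul_assoc] at h2
      have h3 : RCLike.re ((t : ℂ) * (z * inner ℂ (T x) x)) = t * (z * inner ℂ (T x) x).re := by
        simp
      rw [h3] at h2
      nlinarith [sq_nonneg ‖T x‖]
    -- This `t` makes the left side of `bound` equal to the right side plus one.
    have h1 := bound ((‖A‖ ^ 2 * ‖x‖ ^ 2 + 1) / (2 * (z * inner ℂ (T x) x).re)) (by positivity)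
    have h2 : 2 * ((‖A‖ ^ 2 * ‖x‖ ^ 2 + 1) / (2 * (z * inner ℂ (T x) x).re)) *
        (z * inner ℂ (T x) x).re = ‖A‖ ^ 2 * ‖x‖ ^ 2 + 1 := by
      field_simp
    linarith
  rw [ContinuousLinearMap.isPositive_iff_complex]
  intro x
  -- The direction `-1` gives a nonnegative real part; the directions `±I` force the imaginary part
  -- to vanish.
  have h1 := key x (-1) (by simp)
  have h2 := key x Complex.I (by simp)
  have h3 := key x (-Complex.I) (by simp)
  simp at h1 h2 h3
  refine ⟨Complex.ext (by simp) (by simp; linarith), by simpa using h1⟩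

end MatOp

/-! ### Unital completely positive maps -/

section UCP

variable {S : Type u} [AddCommGroup S] [Module ℂ S] [StarAddMonoid S] [StarModule ℂ S]
  [OperatorSystem S] {H : Type u} [NormedAddCommGroup H] [InnerProductSpace ℂ H]

theorem IsCompleteOrderEmbedding.isUCP {ι : S →ₗ[ℂ] (H →L[ℂ] H)}
    (hι : IsCompleteOrderEmbedding ι) : IsUCP ι :=
  ⟨hι.1, fun n X hX => (hι.2 n X).1 hX⟩

/-- An element of the kernel and its negative are both positive at level one, and the cone is
proper. -/
theorem IsCompleteOrderEmbedding.injective {ι : S →ₗ[ℂ] (H →L[ℂ] H)}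
    (hι : IsCompleteOrderEmbedding ι) : Function.Injective ι := by
  rw [injective_iff_map_eq_zero]
  intro s hs
  have h : ∀ t : S, ι t = 0 → Matrix.of (fun _ _ : Fin 1 => t) ∈ OperatorSystem.pos 1 := by
    intro t ht
    rw [hι.2, matOp_isPositive_iff]
    simp [ht]
  have h0 := OperatorSystem.eq_zero_of_mem_of_neg_mem (h s hs) (h (-s) (by simp [hs]))
  exact congrFun (congrFun h0 0) 0

variable [CompleteSpace H]

/-- Adding a large multiple of the order unit makes `s` positive; its image is then positive, hence
self-adjoint, and the real multiple of `1` can be subtracted again. -/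
theorem IsUCP.isSelfAdjoint_map {φ : S →ₗ[ℂ] (H →L[ℂ] H)} (hφ : IsUCP φ) {s : S}
    (hs : IsSelfAdjoint s) : IsSelfAdjoint (φ s) := by
  have hX : (Matrix.of fun _ _ : Fin 1 => s).IsHermitian := by
    ext i j
    exact hs
  obtain ⟨r, -, hr⟩ := OperatorSystem.order_unit hX
  have h1 := (matOp_isPositive_iff _).1 (hφ.2 _ _ hr)
  have h2 : ((r : ℂ) • (1 : H →L[ℂ] H) + φ s).IsPositive := by
    rw [ContinuousLinearMap.isPositive_iff_complex]
    intro x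
    have h3 := h1 fun _ => x
    have e : ((r : ℂ) • Matrix.diagonal (fun _ : Fin 1 => (OperatorSystem.unit : S)) +
        Matrix.of fun _ _ : Fin 1 => s) 0 0 = (r : ℂ) • OperatorSystem.unit + s := by
      simp
    rw [Fin.sum_univ_one, Fin.sum_univ_one, Matrix.map_apply, e, map_add, map_smul, hφ.1] at h3
    rw [← inner_conj_symm]
    generalize inner ℂ x (((r : ℂ) • (1 : H →L[ℂ] H) + φ s) x) = w at h3
    rw [Complex.le_def] at h3
    simp only [Complex.zero_re, Complex.zero_im] at h3
    exact ⟨Complex.ext (by simp) (by simp [← h3.2]), by simpa using h3.1⟩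
  have h4 := h2.isSelfAdjoint
  have h5 : IsSelfAdjoint ((r : ℂ) • (1 : H →L[ℂ] H)) :=
    IsSelfAdjoint.smul (by simp [IsSelfAdjoint]) (IsSelfAdjoint.one _)
  simpa using h4.sub h5

theorem IsUCP.map_star {φ : S →ₗ[ℂ] (H →L[ℂ] H)} (hφ : IsUCP φ) (s : S) :
    φ (star s) = star (φ s) := by
  have h1 := hφ.isSelfAdjoint_map (realPart s).2
  have h2 := hφ.isSelfAdjoint_map (imaginaryPart s).2
  conv_lhs => rw [← realPart_add_I_smul_imaginaryPart s]
  conv_rhs => rw [← realPart_add_I_smul_imaginaryPart s]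
  simp only [star_add, star_smul, map_add, map_smul, (realPart s).2.star_eq,
    (imaginaryPart s).2.star_eq, h1.star_eq, h2.star_eq]

/-- Unital completely positive maps are completely contractive. -/
theorem IsUCP.norm_matOp_map_le {L : Type u} [NormedAddCommGroup L] [InnerProductSpace ℂ L]
    [CompleteSpace L] {ι : S →ₗ[ℂ] (H →L[ℂ] H)} (hι : IsCompleteOrderEmbedding ι)
    {φ : S →ₗ[ℂ] (L →L[ℂ] L)} (hφ : IsUCP φ) {n : ℕ} (X : Matrix (Fin n) (Fin n) S) :
    ‖matOp (X.map φ)‖ ≤ ‖matOp (X.map ι)‖ := by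
  -- The block matrix trick: for `C > 0`, positivity of `[[C, X], [X*, C]]` is equivalent to `‖X‖ ≤
  -- C`, which expresses a norm bound through the order that `φ` preserves.
  let P : ℝ → Matrix (Fin n ⊕ Fin n) (Fin n ⊕ Fin n) S := fun C =>
    Matrix.fromBlocks ((C : ℂ) • Matrix.diagonal fun _ => OperatorSystem.unit) X
      X.conjTranspose ((C : ℂ) • Matrix.diagonal fun _ => OperatorSystem.unit)
  have form : ∀ (E : Type u) [NormedAddCommGroup E] [InnerProductSpace ℂ E] [CompleteSpace E]
      (θ : S →ₗ[ℂ] (E →L[ℂ] E)), IsUCP θ → ∀ C : ℝ,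
      ((matOp (((P C).reindex finSumFinEquiv finSumFinEquiv).map θ)).IsPositive ↔
        ∀ v w : Fin n → E, 0 ≤ C * ∑ i, ‖v i‖ ^ 2 + C * ∑ i, ‖w i‖ ^ 2 +
          2 * (∑ i, ∑ j, inner ℂ (v i) (θ (X i j) (w j))).re) := by
    intro E _ _ _ θ hθ C
    have diag : ∀ u : Fin n → E, ∑ i, ∑ j, inner ℂ (u i)
        (θ (((C : ℂ) • Matrix.diagonal fun _ : Fin n => (OperatorSystem.unit : S)) i j) (u j)) =
        ((C * ∑ i, ‖u i‖ ^ 2 : ℝ) : ℂ) := by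
      intro u
      rw [Finset.mul_sum, Complex.ofReal_sum]
      refine Finset.sum_congr rfl fun i _ => ?_
      rw [Finset.sum_eq_single i]
      · simp [hθ.1, inner_self_eq_norm_sq_to_K]
      · intro j _ hj
        simp [Matrix.diagonal_apply_ne' _ hj]
      · simp
    have off : ∀ v w : Fin n → E, ∑ i, ∑ j, inner ℂ (w i) (θ (X.conjTranspose i j) (v j)) =
        starRingEnd ℂ (∑ i, ∑ j, inner ℂ (v i) (θ (X i j) (w j))) := by
      intro v w
      rw [Finset.sum_comm]
      simp only [map_sum, Matrix.conjTranspose_apply, hθ.map_star, inner_conj_symm,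
        ContinuousLinearMap.star_eq_adjoint, ContinuousLinearMap.adjoint_inner_right]
    have total : ∀ v w : Fin n → E,
        ∑ i, ∑ j, inner ℂ (Sum.elim v w i) (θ (P C i j) (Sum.elim v w j)) =
        ((C * ∑ i, ‖v i‖ ^ 2 + C * ∑ i, ‖w i‖ ^ 2 +
          2 * (∑ i, ∑ j, inner ℂ (v i) (θ (X i j) (w j))).re : ℝ) : ℂ) := by
      intro v w
      simp only [Fintype.sum_sum_type, Sum.elim_inl, Sum.elim_inr, P, Matrix.fromBlocks_apply₁₁,
        Matrix.fromBlocks_apply₁₂, Matrix.fromBlocks_apply₂₁, Matrix.fromBlocks_apply₂₂,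
        Finset.sum_add_distrib]
      rw [diag, diag, off v w]
      generalize C * ∑ i, ‖v i‖ ^ 2 = a
      generalize C * ∑ i, ‖w i‖ ^ 2 = b
      generalize ∑ i, ∑ j, inner ℂ (v i) (θ (X i j) (w j)) = z
      apply Complex.ext <;> simp
      ring
    rw [matOp_isPositive_iff]
    have reind : ∀ u : Fin (n + n) → E, ∑ i, ∑ j,
        inner ℂ (u i) ((((P C).reindex finSumFinEquiv finSumFinEquiv).map θ) i j (u j)) =
        ∑ i, ∑ j, inner ℂ (u (finSumFinEquiv i)) (θ (P C i j) (u (finSumFinEquiv j))) := by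
      intro u
      rw [← finSumFinEquiv.sum_comp]
      refine Finset.sum_congr rfl fun i _ => ?_
      rw [← finSumFinEquiv.sum_comp]
      simp
    constructor
    · intro h v w
      have h1 := h (Sum.elim v w ∘ finSumFinEquiv.symm)
      rw [reind] at h1
      simp only [Function.comp_apply, Equiv.symm_apply_apply] at h1
      rw [total] at h1
      exact Complex.zero_le_real.1 h1
    · intro h u
      obtain ⟨v, w, rfl⟩ : ∃ v w : Fin n → E, u = Sum.elim v w ∘ finSumFinEquiv.symm := by
        refine ⟨fun i => u (finSumFinEquiv (Sum.inl i)),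
          fun i => u (finSumFinEquiv (Sum.inr i)), ?_⟩
        ext i
        obtain ⟨j, rfl⟩ := finSumFinEquiv.surjective i
        rw [Function.comp_apply, Equiv.symm_apply_apply]
        cases j <;> rfl
      rw [reind]
      simp only [Function.comp_apply, Equiv.symm_apply_apply]
      rw [total]
      exact Complex.zero_le_real.2 (h _ _)
  refine le_of_forall_pos_le_add fun ε hε => ?_
  -- The `ε` keeps `C` positive, since `C⁻¹` enters below.
  set C : ℝ := ‖matOp (X.map ι)‖ + ε
  have hC : 0 < C := by positivity
  have h1 : ((P C).reindex finSumFinEquiv finSumFinEquiv) ∈ OperatorSystem.pos (n + n) := by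
    rw [hι.2, form H ι hι.isUCP]
    intro v w
    let v' : PiLp 2 (fun _ : Fin n => H) := WithLp.toLp 2 v
    let w' : PiLp 2 (fun _ : Fin n => H) := WithLp.toLp 2 w
    have e1 : ∑ i, ‖v i‖ ^ 2 = ‖v'‖ ^ 2 := (PiLp.norm_sq_eq_of_L2 _ v').symm
    have e2 : ∑ i, ‖w i‖ ^ 2 = ‖w'‖ ^ 2 := (PiLp.norm_sq_eq_of_L2 _ w').symm
    have e3 : ∑ i, ∑ j, inner ℂ (v i) (ι (X i j) (w j)) = inner ℂ v' (matOp (X.map ι) w') := by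
      simp [PiLp.inner_apply, matOp_apply, inner_sum, v', w']
    rw [e1, e2, e3]
    have h2 : |(inner ℂ v' (matOp (X.map ι) w')).re| ≤ C * (‖v'‖ * ‖w'‖) := by
      refine (Complex.abs_re_le_norm _).trans ((norm_inner_le_norm _ _).trans ?_)
      have : ‖matOp (X.map ι) w'‖ ≤ C * ‖w'‖ :=
        ContinuousLinearMap.le_of_opNorm_le _ (by simp [C, hε.le]) _
      calc _ ≤ ‖v'‖ * (C * ‖w'‖) := by gcongr
        _ = _ := by ring
    have h3 := (abs_le.1 h2).1
    nlinarith [mul_nonneg hC.le (sq_nonneg (‖v'‖ - ‖w'‖))]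
  have h2 := (form L φ hφ C).1 (hφ.2 _ _ h1)
  rw [norm_matOp_le_iff _ hC.le]
  intro w
  -- For fixed `w` the form is minimal at `v = -C⁻¹ φ(X) w`, where its value is `C ‖w‖² - C⁻¹ ‖φ(X)
  -- w‖²`.
  have h3 := h2 (fun i => ((-C⁻¹ : ℝ) : ℂ) • ∑ j, φ (X i j) (w j)) w
  have e : ∀ i, ∑ j, inner ℂ (((-C⁻¹ : ℝ) : ℂ) • ∑ j, φ (X i j) (w j)) (φ (X i j) (w j)) =
      ((-C⁻¹ * ‖∑ j, φ (X i j) (w j)‖ ^ 2 : ℝ) : ℂ) := by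
    intro i
    rw [← inner_sum, inner_smul_left, inner_self_eq_norm_sq_to_K]
    simp
  simp only [e, norm_smul, mul_pow, ← Complex.ofReal_sum, Complex.ofReal_re,
    ← Finset.mul_sum] at h3
  have e4 : ‖((-C⁻¹ : ℝ) : ℂ)‖ ^ 2 = C⁻¹ ^ 2 := by
    rw [Complex.norm_real, Real.norm_eq_abs, sq_abs, neg_sq]
  rw [e4] at h3
  simp only [Matrix.map_apply]
  set A := ∑ i, ‖∑ j, φ (X i j) (w j)‖ ^ 2
  set B := ∑ i, ‖w i‖ ^ 2
  have h5 : C * (C⁻¹ ^ 2 * A) + C * B + 2 * (-C⁻¹ * A) = C * B - C⁻¹ * A := by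
    field_simp
    ring
  rw [h5] at h3
  have h6 : C * (C * B - C⁻¹ * A) = C ^ 2 * B - A := by
    field_simp
  nlinarith [mul_nonneg hC.le h3]

end UCP

/-! ### The Stinespring dilation of a unital completely positive map on a C⋆-algebra, and the
lift of its commutant -/

section Dilation

variable {D : Type u} [CStarAlgebra D] {L : Type u} [NormedAddCommGroup L] [InnerProductSpace ℂ L]

/-- The left factors are shared by all the `v k`, so that one finite Gram matrix controls the whole
family. -/
theorem exists_fin_sum_tmul {V W : Type u} [AddCommGroup V] [Module ℂ V] [AddCommGroup W]
    [Module ℂ W] {N : ℕ} (v : Fin N → V ⊗[ℂ] W) :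
    ∃ (m : ℕ) (d : Fin m → V) (ξ : Fin N → Fin m → W), ∀ k, v k = ∑ i, d i ⊗ₜ[ℂ] ξ k i := by
  obtain ⟨M, hM, h⟩ := TensorProduct.exists_finite_submodule_left_of_setFinite
    (Set.range v) (Set.finite_range v)
  let b := Module.finBasis ℂ M
  have h1 : ∀ k, ∃ c : Fin (Module.finrank ℂ M) → W, v k = ∑ i, (b i : V) ⊗ₜ[ℂ] c i := by
    intro k
    obtain ⟨x, hx⟩ := h (Set.mem_range_self k)
    obtain ⟨c, hc⟩ := TensorProduct.eq_repr_basis_left b x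
    refine ⟨c, ?_⟩
    rw [← hx, ← hc, Finsupp.sum_fintype _ _ (by simp)]
    simp
  choose ξ hξ using h1
  exact ⟨_, fun i => b i, ξ, hξ⟩

/-- The sesquilinear form `⟨d ⊗ ξ, e ⊗ η⟩ = ⟨ξ, ψ(d* e) η⟩` on `D ⊗ L`. -/
def dilationForm (ψ : D →ₗ[ℂ] (L →L[ℂ] L)) : D ⊗[ℂ] L →ₗ⋆[ℂ] D ⊗[ℂ] L →ₗ[ℂ] ℂ :=
  TensorProduct.lift <| LinearMap.mk₂'ₛₗ (starRingEnd ℂ) (starRingEnd ℂ)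
    (fun d ξ => TensorProduct.lift <| LinearMap.mk₂ ℂ
      (fun e η => inner ℂ ξ (ψ (star d * e) η))
      (fun e e' η => by simp [mul_add])
      (fun c e η => by simp)
      (fun e η η' => by simp)
      (fun c e η => by simp))
    (fun d d' ξ => by ext; simp [add_mul])
    (fun c d ξ => by ext; simp)
    (fun d ξ ξ' => by ext; simp)
    (fun c d ξ => by ext; simp [mul_comm])

@[simp]
theorem dilationForm_tmul (ψ : D →ₗ[ℂ] (L →L[ℂ] L)) (d e : D) (ξ η : L) :
    dilationForm ψ (d ⊗ₜ ξ) (e ⊗ₜ η) = inner ℂ ξ (ψ (star d * e) η) := rfl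

theorem dilationForm_sum_tmul (ψ : D →ₗ[ℂ] (L →L[ℂ] L)) {m : ℕ} (d : Fin m → D)
    (ξ η : Fin m → L) :
    dilationForm ψ (∑ i, d i ⊗ₜ ξ i) (∑ i, d i ⊗ₜ η i) =
      ∑ i, ∑ j, inner ℂ (ξ i) (ψ (star (d i) * d j) (η j)) := by
  simp only [map_sum, LinearMap.sum_apply, dilationForm_tmul]
  exact Finset.sum_comm

/-- Both sides reduce to `ψ(d* a* e)`; this makes the Stinespring representation star-preserving. -/
theorem dilationForm_rTensor_mulLeft (ψ : D →ₗ[ℂ] (L →L[ℂ] L)) (a : D) (v w : D ⊗[ℂ] L) :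
    dilationForm ψ ((LinearMap.mulLeft ℂ a).rTensor L v) w =
      dilationForm ψ v ((LinearMap.mulLeft ℂ (star a)).rTensor L w) := by
  induction v with
  | zero => simp
  | add v v' hv hv' => simp [hv, hv']
  | tmul d ξ =>
    induction w with
    | zero => simp
    | add w w' hw hw' => simp only [map_add, hw, hw']
    | tmul e η => simp [mul_assoc]

/-- The matrix `[ψ(dᵢ* dⱼ)]`. -/
def gramOp (ψ : D →ₗ[ℂ] (L →L[ℂ] L)) {m : ℕ} (d : Fin m → D) :
    Matrix (Fin m) (Fin m) (L →L[ℂ] L) :=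
  Matrix.of fun i j => ψ (star (d i) * d j)

/-- The matrix `[dᵢ* dⱼ]` is `Z* Z` for the row `Z = (d₁, …, d_m)`, hence positive over `D`. -/
theorem IsUCP.gramOp_isPositive {ψ : D →ₗ[ℂ] (L →L[ℂ] L)} (hψ : IsUCP ψ) {m : ℕ} (d : Fin m → D) :
    (matOp (gramOp ψ d)).IsPositive := by
  let _ := CStarAlgebra.spectralOrder D
  have _ := CStarAlgebra.spectralOrderedRing D
  let Z : Matrix (Fin 1) (Fin m) D := Matrix.of fun _ j => d j
  have h : Z.conjTranspose * Z ∈ OperatorSystem.pos m :=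
    (exists_gram_iff_nonneg _).2 (conjTranspose_mul_self_nonneg_rect Z)
  have e : (Z.conjTranspose * Z).map ψ = gramOp ψ d := by
    ext1 i j
    simp [Matrix.mul_apply, Z, gramOp]
  rw [← e]
  exact hψ.2 _ _ h

theorem IsUCP.dilationForm_self_nonneg {ψ : D →ₗ[ℂ] (L →L[ℂ] L)} (hψ : IsUCP ψ)
    (v : D ⊗[ℂ] L) : 0 ≤ dilationForm ψ v v := by
  obtain ⟨m, d, ξ, h⟩ := exists_fin_sum_tmul (fun _ : Fin 1 => v)
  rw [h 0, dilationForm_sum_tmul]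
  exact (matOp_isPositive_iff _).1 (hψ.gramOp_isPositive d) (ξ 0)

variable [CompleteSpace L]

theorem IsUCP.conj_dilationForm {ψ : D →ₗ[ℂ] (L →L[ℂ] L)} (hψ : IsUCP ψ) (v w : D ⊗[ℂ] L) :
    starRingEnd ℂ (dilationForm ψ w v) = dilationForm ψ v w := by
  induction v with
  | zero => simp
  | add v v' hv hv' => simp only [map_add, LinearMap.add_apply, hv, hv']
  | tmul d ξ =>
    induction w with
    | zero => simp
    | add w w' hw hw' => simp only [map_add, LinearMap.add_apply, hw, hw']
    | tmul e η =>
      rw [dilationForm_tmul, dilationForm_tmul, inner_conj_symm,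
        ← ContinuousLinearMap.adjoint_inner_right, ← ContinuousLinearMap.star_eq_adjoint,
        ← hψ.map_star]
      simp

/-- The space `D ⊗ L` with the inner product `⟨d ⊗ ξ, e ⊗ η⟩ = ⟨ξ, ψ(d* e) η⟩`. -/
def PreDilation {ψ : D →ₗ[ℂ] (L →L[ℂ] L)} (_ : IsUCP ψ) : Type u := D ⊗[ℂ] L

variable {ψ : D →ₗ[ℂ] (L →L[ℂ] L)} (hψ : IsUCP ψ)

instance : AddCommGroup (PreDilation hψ) := inferInstanceAs (AddCommGroup (D ⊗[ℂ] L))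

instance : Module ℂ (PreDilation hψ) := inferInstanceAs (Module ℂ (D ⊗[ℂ] L))

/-- The identity `D ⊗ L → PreDilation hψ`. -/
def toPreDilation : (D ⊗[ℂ] L) ≃ₗ[ℂ] PreDilation hψ := LinearEquiv.refl ℂ _

/-- The form `dilationForm ψ` as a semi-inner product. -/
abbrev preDilationCore : PreInnerProductSpace.Core ℂ (PreDilation hψ) where
  inner v w := dilationForm ψ ((toPreDilation hψ).symm v) ((toPreDilation hψ).symm w)
  conj_inner_symm v w := hψ.conj_dilationForm _ _
  re_inner_nonneg v := (RCLike.nonneg_iff.1 (hψ.dilationForm_self_nonneg _)).1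
  add_left _ _ _ := by simp
  smul_left _ _ _ := by simp

/-- The form may be degenerate, so this is only a seminorm. Null vectors need no separate quotient,
because `UniformSpace.Completion` identifies them with zero. -/
instance : SeminormedAddCommGroup (PreDilation hψ) :=
  InnerProductSpace.Core.toSeminormedAddCommGroup (c := preDilationCore hψ)

instance : InnerProductSpace ℂ (PreDilation hψ) := InnerProductSpace.ofCore (preDilationCore hψ)

theorem inner_toPreDilation (v w : D ⊗[ℂ] L) :
    inner ℂ (toPreDilation hψ v) (toPreDilation hψ w) = dilationForm ψ v w := rfl

theorem norm_sq_toPreDilation (v : D ⊗[ℂ] L) :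
    ((‖toPreDilation hψ v‖ ^ 2 : ℝ) : ℂ) = dilationForm ψ v v := by
  rw [← inner_toPreDilation hψ, inner_self_eq_norm_sq_to_K]
  simp

/-- Writing `‖a‖² - a* a = b* b` gives `‖a‖² ⟨v, v⟩ = ⟨a v, a v⟩ + ⟨b v, b v⟩`, and the last term is
nonnegative. -/
theorem norm_toPreDilation_mulLeft_le (a : D) (v : D ⊗[ℂ] L) :
    ‖toPreDilation hψ ((LinearMap.mulLeft ℂ a).rTensor L v)‖ ≤ ‖a‖ * ‖toPreDilation hψ v‖ := by
  let _ := CStarAlgebra.spectralOrder D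
  have _ := CStarAlgebra.spectralOrderedRing D
  obtain ⟨b, hb⟩ := CStarAlgebra.nonneg_iff_eq_star_mul_self.1
    (sub_nonneg.2 (CStarAlgebra.star_mul_le_algebraMap_norm_sq (a := a)))
  have comp : ∀ c : D, dilationForm ψ ((LinearMap.mulLeft ℂ c).rTensor L v)
      ((LinearMap.mulLeft ℂ c).rTensor L v) =
      dilationForm ψ v ((LinearMap.mulLeft ℂ (star c * c)).rTensor L v) := by
    intro c
    rw [dilationForm_rTensor_mulLeft, LinearMap.mulLeft_mul, LinearMap.rTensor_comp,
      LinearMap.comp_apply]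
  have h1 : ((‖a‖ ^ 2 : ℝ) : ℂ) * dilationForm ψ v v =
      dilationForm ψ ((LinearMap.mulLeft ℂ a).rTensor L v) ((LinearMap.mulLeft ℂ a).rTensor L v) +
      dilationForm ψ ((LinearMap.mulLeft ℂ b).rTensor L v)
        ((LinearMap.mulLeft ℂ b).rTensor L v) := by
    rw [comp, comp, ← hb, ← map_add, ← LinearMap.add_apply, ← LinearMap.rTensor_add]
    have e : LinearMap.mulLeft ℂ (star a * a) +
        LinearMap.mulLeft ℂ (algebraMap ℝ D (‖a‖ ^ 2) - star a * a) =
        ((‖a‖ ^ 2 : ℝ) : ℂ) • LinearMap.id := by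
      ext x
      simp [Algebra.algebraMap_eq_smul_one, sub_mul, mul_assoc, ← Complex.coe_smul]
    rw [e, LinearMap.rTensor_smul, LinearMap.rTensor_id]
    simp
  simp only [← norm_sq_toPreDilation hψ] at h1
  norm_cast at h1
  rw [← sq_le_sq₀ (norm_nonneg _) (by positivity), mul_pow, h1]
  exact le_add_of_nonneg_right (sq_nonneg _)

/-- Matrices with entries in the commutant of `ψ` act boundedly on the dilation. -/
theorem sum_norm_sq_lTensor_le {N : ℕ} (T : Matrix (Fin N) (Fin N) (L →L[ℂ] L))
    (hT : ∀ k l d, Commute (T k l) (ψ d)) (v : Fin N → D ⊗[ℂ] L) :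
    ∑ k, ‖∑ l, toPreDilation hψ ((T k l).toLinearMap.lTensor D (v l))‖ ^ 2 ≤
      ‖matOp T‖ ^ 2 * ∑ l, ‖toPreDilation hψ (v l)‖ ^ 2 := by
  obtain ⟨m, d, ξ, hv⟩ := exists_fin_sum_tmul v
  have hP := hψ.gramOp_isPositive d
  set P := matOp (gramOp ψ d)
  have hP' : 0 ≤ P := (ContinuousLinearMap.nonneg_iff_isPositive P).2 hP
  -- With `P = Q²` the dilation norm of `∑ dᵢ ⊗ ηᵢ` becomes the ordinary norm of `Q η` in `L^m`. The
  -- estimate then reduces to the action of `T` on the coordinates of the vectors `Q ξ_l`, provided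
  -- that `T` passes through `Q`.
  let Q := CFC.sqrt P
  have hQ : IsSelfAdjoint Q := IsSelfAdjoint.of_nonneg (CFC.sqrt_nonneg P)
  have hQP : Q * Q = P := CFC.sqrt_mul_sqrt_self P
  let T' : Fin N → Fin N → (PiLp 2 (fun _ : Fin m => L) →L[ℂ] PiLp 2 (fun _ : Fin m => L)) :=
    fun k l => matOp (Matrix.diagonal fun _ => T k l)
  have T'_apply : ∀ k l x i, T' k l x i = T k l (x i) := by
    intro k l x i
    rw [matOp_apply, Finset.sum_eq_single i]
    · simp
    · intro j _ hj
      simp [Matrix.diagonal_apply_ne' _ hj]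
    · simp
  have hcomm : ∀ k l, Commute (T' k l) Q := by
    intro k l
    have : Commute P (T' k l) := by
      change matOp _ * matOp _ = matOp _ * matOp _
      rw [← matOp_mul, ← matOp_mul]
      -- Commutation with `P` is checked entrywise and holds as the entries of `P` are values of
      -- `ψ`; the functional calculus carries it over to the square root.
      congr 1
      ext1 i j
      rw [Matrix.mul_diagonal, Matrix.diagonal_mul]
      exact (hT k l _).symm.eq
    exact (this.cfcₙ_nnreal _).symm
  have norm_eq : ∀ η : Fin m → L, ‖toPreDilation hψ (∑ i, d i ⊗ₜ[ℂ] η i)‖ ^ 2 =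
      ‖Q (WithLp.toLp 2 η)‖ ^ 2 := by
    intro η
    rw [← Complex.ofReal_inj, norm_sq_toPreDilation, dilationForm_sum_tmul]
    have h1 : ((‖Q (WithLp.toLp 2 η)‖ ^ 2 : ℝ) : ℂ) =
        inner ℂ (WithLp.toLp 2 η) (P (WithLp.toLp 2 η)) := by
      rw [← hQP, mul_apply_eq_comp, ← ContinuousLinearMap.adjoint_inner_left,
        ← ContinuousLinearMap.star_eq_adjoint, hQ.star_eq, inner_self_eq_norm_sq_to_K]
      simp
    rw [h1, PiLp.inner_apply]
    simp [P, matOp_apply, inner_sum, gramOp]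
  have hsum : ∀ k, ∑ l, toPreDilation hψ ((T k l).toLinearMap.lTensor D (v l)) =
      toPreDilation hψ (∑ i, d i ⊗ₜ[ℂ] (∑ l, T k l (ξ l i))) := by
    intro k
    rw [← map_sum]
    congr 1
    simp only [hv, map_sum, TensorProduct.tmul_sum]
    rw [Finset.sum_comm]
    simp
  have hQT : ∀ k, Q (WithLp.toLp 2 fun i => ∑ l, T k l (ξ l i)) =
      ∑ l, T' k l (Q (WithLp.toLp 2 (ξ l))) := by
    intro k
    have : (WithLp.toLp 2 fun i => ∑ l, T k l (ξ l i)) = ∑ l, T' k l (WithLp.toLp 2 (ξ l)) := by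
      ext i
      simp [T'_apply]
    rw [this, map_sum]
    refine Finset.sum_congr rfl fun l _ => ?_
    rw [← mul_apply_eq_comp, ← mul_apply_eq_comp, (hcomm k l).eq]
  calc ∑ k, ‖∑ l, toPreDilation hψ ((T k l).toLinearMap.lTensor D (v l))‖ ^ 2
      = ∑ k, ∑ i, ‖∑ l, T k l (Q (WithLp.toLp 2 (ξ l)) i)‖ ^ 2 := by
        refine Finset.sum_congr rfl fun k _ => ?_
        rw [hsum, norm_eq, hQT, PiLp.norm_sq_eq_of_L2]
        simp [T'_apply]
    _ = ∑ i, ∑ k, ‖∑ l, T k l (Q (WithLp.toLp 2 (ξ l)) i)‖ ^ 2 := Finset.sum_comm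
    _ ≤ ∑ i, ‖matOp T‖ ^ 2 * ∑ l, ‖Q (WithLp.toLp 2 (ξ l)) i‖ ^ 2 :=
        Finset.sum_le_sum fun i _ => sum_norm_sq_le_norm_matOp T _
    _ = ‖matOp T‖ ^ 2 * ∑ l, ‖toPreDilation hψ (v l)‖ ^ 2 := by
        rw [← Finset.mul_sum, Finset.sum_comm]
        congr 1
        refine Finset.sum_congr rfl fun l _ => ?_
        rw [hv, norm_eq, PiLp.norm_sq_eq_of_L2]

/-- The Stinespring representation `a ↦ (d ⊗ ξ ↦ a d ⊗ ξ)` before completion. -/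
def preDilationMulLeft (a : D) : PreDilation hψ →L[ℂ] PreDilation hψ :=
  ((toPreDilation hψ).toLinearMap ∘ₗ (LinearMap.mulLeft ℂ a).rTensor L ∘ₗ
    (toPreDilation hψ).symm.toLinearMap).mkContinuous ‖a‖
      fun v => norm_toPreDilation_mulLeft_le hψ a v

@[simp]
theorem preDilationMulLeft_apply (a : D) (v : D ⊗[ℂ] L) :
    preDilationMulLeft hψ a (toPreDilation hψ v) =
      toPreDilation hψ ((LinearMap.mulLeft ℂ a).rTensor L v) := rfl

/-- The action `d ⊗ ξ ↦ d ⊗ T ξ` of an element of the commutant of `ψ` before completion. -/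
def preDilationCommutant (T : L →L[ℂ] L) (hT : ∀ d, Commute T (ψ d)) :
    PreDilation hψ →L[ℂ] PreDilation hψ :=
  ((toPreDilation hψ).toLinearMap ∘ₗ T.toLinearMap.lTensor D ∘ₗ
    (toPreDilation hψ).symm.toLinearMap).mkContinuous ‖matOp (Matrix.of fun _ _ : Fin 1 => T)‖
      fun v => by
        have h := sum_norm_sq_lTensor_le hψ (Matrix.of fun _ _ : Fin 1 => T)
          (fun _ _ => hT) fun _ => v
        simp only [Fin.sum_univ_one, ← mul_pow] at h
        exact (sq_le_sq₀ (norm_nonneg _) (by positivity)).1 h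

@[simp]
theorem preDilationCommutant_apply (T : L →L[ℂ] L) (hT : ∀ d, Commute T (ψ d)) (v : D ⊗[ℂ] L) :
    preDilationCommutant hψ T hT (toPreDilation hψ v) =
      toPreDilation hψ (T.toLinearMap.lTensor D v) := rfl

/-- Operators on the completed dilation space agree if they agree on `D ⊗ L`. -/
theorem dilation_ext {f g : UniformSpace.Completion (PreDilation hψ) →L[ℂ]
    UniformSpace.Completion (PreDilation hψ)}
    (h : ∀ v, f (toPreDilation hψ v) = g (toPreDilation hψ v)) : f = g :=
  DFunLike.coe_injective (UniformSpace.Completion.ext f.continuous g.continuous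
    fun a => h ((toPreDilation hψ).symm a))

/-- The Stinespring representation of `ψ`. -/
def dilationRep : D →⋆ₐ[ℂ] (UniformSpace.Completion (PreDilation hψ) →L[ℂ]
    UniformSpace.Completion (PreDilation hψ)) where
  toFun a := (preDilationMulLeft hψ a).completion
  map_one' := by
    refine dilation_ext hψ fun v => ?_
    simp
  map_mul' a b := by
    refine dilation_ext hψ fun v => ?_
    simp [LinearMap.mulLeft_mul, LinearMap.rTensor_comp]
  map_zero' := by
    refine dilation_ext hψ fun v => ?_
    simp [UniformSpace.Completion.coe_zero]
  map_add' a b := by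
    refine dilation_ext hψ fun v => ?_
    have : LinearMap.mulLeft ℂ (a + b) = LinearMap.mulLeft ℂ a + LinearMap.mulLeft ℂ b := by
      ext; simp [add_mul]
    simp [this, LinearMap.rTensor_add, UniformSpace.Completion.coe_add]
  commutes' c := by
    refine dilation_ext hψ fun v => ?_
    have : LinearMap.mulLeft ℂ (algebraMap ℂ D c) = c • LinearMap.id := by
      ext; simp [Algebra.algebraMap_eq_smul_one]
    rw [ContinuousLinearMap.completion_apply_coe, preDilationMulLeft_apply, this,
      LinearMap.rTensor_smul, LinearMap.rTensor_id]
    simp [Algebra.algebraMap_eq_smul_one]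
  map_star' a := by
    rw [ContinuousLinearMap.star_eq_adjoint, ContinuousLinearMap.eq_adjoint_iff]
    intro x y
    induction x, y using UniformSpace.Completion.induction_on₂ with
    | hp => apply isClosed_eq <;> fun_prop
    | ih x y =>
      obtain ⟨v, rfl⟩ := (toPreDilation hψ).surjective x
      obtain ⟨w, rfl⟩ := (toPreDilation hψ).surjective y
      simp [inner_toPreDilation, dilationForm_rTensor_mulLeft]

@[simp]
theorem dilationRep_coe (a : D) (v : D ⊗[ℂ] L) :
    dilationRep hψ a (toPreDilation hψ v : UniformSpace.Completion (PreDilation hψ)) =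
      toPreDilation hψ ((LinearMap.mulLeft ℂ a).rTensor L v) :=
  ContinuousLinearMap.completion_apply_coe _ _

variable {S : Type u} [AddCommGroup S] [Module ℂ S] (φ : S →ₗ[ℂ] (L →L[ℂ] L))
  (hφψ : ∀ s d, Commute (φ s) (ψ d))

/-- The lift of a map into the commutant of `ψ` to the Stinespring space of `ψ`. -/
def dilationLift : S →ₗ[ℂ] (UniformSpace.Completion (PreDilation hψ) →L[ℂ]
    UniformSpace.Completion (PreDilation hψ)) where
  toFun s := (preDilationCommutant hψ (φ s) (hφψ s)).completion
  map_add' s t := by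
    refine dilation_ext hψ fun v => ?_
    simp [LinearMap.lTensor_add, UniformSpace.Completion.coe_add]
  map_smul' c s := by
    refine dilation_ext hψ fun v => ?_
    simp [LinearMap.lTensor_smul]

@[simp]
theorem dilationLift_coe (s : S) (v : D ⊗[ℂ] L) :
    dilationLift hψ φ hφψ s (toPreDilation hψ v : UniformSpace.Completion (PreDilation hψ)) =
      toPreDilation hψ ((φ s).toLinearMap.lTensor D v) :=
  ContinuousLinearMap.completion_apply_coe _ _

/-- On algebraic tensors this is `sum_norm_sq_lTensor_le`, and density does the rest. With unitality
it is all that is needed of the lift; complete positivity of the lift is never invoked. -/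
theorem norm_matOp_dilationLift_le {N : ℕ} (X : Matrix (Fin N) (Fin N) S) :
    ‖matOp (X.map (dilationLift hψ φ hφψ))‖ ≤ ‖matOp (X.map φ)‖ := by
  rw [norm_matOp_le_iff _ (ContinuousLinearMap.opNorm_nonneg _)]
  intro v
  have hd : DenseRange (Pi.map fun (_ : Fin N) (x : PreDilation hψ) =>
      (x : UniformSpace.Completion (PreDilation hψ))) :=
    DenseRange.piMap fun _ => UniformSpace.Completion.denseRange_coe
  refine hd.induction_on (p := fun v => ∑ i, ‖∑ j, X.map (dilationLift hψ φ hφψ) i j (v j)‖ ^ 2 ≤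
    ‖matOp (X.map φ)‖ ^ 2 * ∑ j, ‖v j‖ ^ 2) v ?_ fun w => ?_
  · exact isClosed_le (by fun_prop) (by fun_prop)
  · have h := sum_norm_sq_lTensor_le hψ (X.map φ) (fun k l d => hφψ _ d)
      fun k => (toPreDilation hψ).symm (w k)
    have e : ∀ i, ‖∑ j, X.map (dilationLift hψ φ hφψ) i j (w j)‖ =
        ‖∑ l, toPreDilation hψ
          ((X.map φ i l).toLinearMap.lTensor D ((toPreDilation hψ).symm (w l)))‖ := by
      intro i
      conv_rhs => rw [← UniformSpace.Completion.norm_coe,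
        ← UniformSpace.Completion.coe_toComplL (𝕜 := ℂ), map_sum]
      refine congrArg norm (Finset.sum_congr rfl fun j _ => ?_)
      exact dilationLift_coe hψ φ hφψ (X i j) ((toPreDilation hψ).symm (w j))
    simp only [Pi.map_apply, e, UniformSpace.Completion.norm_coe]
    exact h

/-- The two operators act on different legs of `D ⊗ L`. -/
theorem commute_dilationLift_dilationRep (s : S) (d : D) :
    Commute (dilationLift hψ φ hφψ s) (dilationRep hψ d) := by
  refine dilation_ext hψ fun v => ?_
  simp only [mul_apply_eq_comp, dilationRep_coe, dilationLift_coe]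
  rw [← LinearMap.comp_apply, ← LinearMap.comp_apply, LinearMap.lTensor_comp_rTensor,
    LinearMap.rTensor_comp_lTensor]

theorem dilationLift_eq_one {s : S} (hs : φ s = 1) : dilationLift hψ φ hφψ s = 1 := by
  refine dilation_ext hψ fun v => ?_
  have : (1 : L →L[ℂ] L).toLinearMap = LinearMap.id := rfl
  rw [dilationLift_coe, hs, this, LinearMap.lTensor_id]
  simp

/-- The isometry `ξ ↦ 1 ⊗ ξ` of `L` into the Stinespring space of `ψ`. -/
def dilationIsometry : L →ₗᵢ[ℂ] UniformSpace.Completion (PreDilation hψ) where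
  toLinearMap := (UniformSpace.Completion.toComplL (𝕜 := ℂ) (E := PreDilation hψ)).toLinearMap ∘ₗ
    (toPreDilation hψ).toLinearMap ∘ₗ TensorProduct.mk ℂ D L 1
  norm_map' ξ := by
    change ‖((toPreDilation hψ (1 ⊗ₜ ξ) : PreDilation hψ) :
      UniformSpace.Completion (PreDilation hψ))‖ = ‖ξ‖
    rw [UniformSpace.Completion.norm_coe, ← sq_eq_sq₀ (norm_nonneg _) (norm_nonneg _),
      ← Complex.ofReal_inj, norm_sq_toPreDilation, dilationForm_tmul, star_one, mul_one]
    have : ψ 1 = 1 := hψ.1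
    rw [this, one_apply_eq_self, inner_self_eq_norm_sq_to_K]
    simp

theorem dilationIsometry_apply (ξ : L) :
    dilationIsometry hψ ξ = (toPreDilation hψ (1 ⊗ₜ ξ) : PreDilation hψ) := rfl

theorem inner_dilationIsometry (s : S) (d : D) (ξ η : L) :
    inner ℂ (dilationIsometry hψ ξ)
      (dilationLift hψ φ hφψ s (dilationRep hψ d (dilationIsometry hψ η))) =
      inner ℂ ξ (φ s (ψ d η)) := by
  rw [dilationIsometry_apply, dilationIsometry_apply, dilationRep_coe, dilationLift_coe,
    UniformSpace.Completion.inner_coe, inner_toPreDilation]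
  simp only [LinearMap.rTensor_tmul, LinearMap.lTensor_tmul, dilationForm_tmul, star_one, one_mul,
    LinearMap.mulLeft_apply, mul_one, ContinuousLinearMap.coe_coe]
  -- The form produces `ψ(d) φ(s)`; commutation restores the order of the factors.
  rw [← mul_apply_eq_comp, ← mul_apply_eq_comp, (hφψ s d).eq]

end Dilation

/-! ### The minimal and the commuting cone -/

section Cones

theorem posSemidef_iff_forall_sum_nonneg {J : Type*} [Fintype J] [DecidableEq J]
    (M : Matrix J J ℂ) :
    M.PosSemidef ↔ ∀ x : J → ℂ, 0 ≤ ∑ p, ∑ q, star (x p) * M p q * x q := by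
  have key : ∀ x : J → ℂ, star x ⬝ᵥ M.mulVec x = ∑ p, ∑ q, star (x p) * M p q * x q := by
    intro x
    simp [dotProduct, Matrix.mulVec, Finset.mul_sum, mul_assoc]
  constructor
  · intro h x
    rw [← key]
    exact h.dotProduct_mulVec_nonneg x
  · intro h
    rw [← Matrix.isPositive_toEuclideanLin_iff, LinearMap.isPositive_iff_complex]
    intro x
    have h1 := h x.ofLp
    rw [← key] at h1
    have h2 : inner ℂ (M.toEuclideanLin x) x = starRingEnd ℂ (star x.ofLp ⬝ᵥ M.mulVec x.ofLp) := by
      rw [← inner_conj_symm, EuclideanSpace.inner_eq_star_dotProduct, dotProduct_comm]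
      rfl
    rw [h2]
    generalize star x.ofLp ⬝ᵥ M.mulVec x.ofLp = w at h1
    rw [Complex.le_def] at h1
    simp only [Complex.zero_re, Complex.zero_im] at h1
    exact ⟨Complex.ext (by simp) (by simp [← h1.2]), by simpa using h1.1⟩

/-- The action of complex matrices on a Euclidean space with an index type lifted to the
universe `u`. -/
def liftedMatrixOp (J : Type) [Fintype J] [DecidableEq J] :
    Matrix J J ℂ →ₐ[ℂ] (EuclideanSpace ℂ (ULift.{u} J) →L[ℂ] EuclideanSpace ℂ (ULift.{u} J)) :=
  (Matrix.toEuclideanCLM (n := ULift.{u} J) (𝕜 := ℂ)).toAlgEquiv.toAlgHom.comp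
    (Matrix.reindexAlgEquiv ℂ ℂ Equiv.ulift.{u}.symm).toAlgHom

theorem liftedMatrixOp_apply (J : Type) [Fintype J] [DecidableEq J] (M : Matrix J J ℂ)
    (x : EuclideanSpace ℂ (ULift.{u} J)) (i : ULift.{u} J) :
    liftedMatrixOp.{u} J M x i = ∑ j, M i.down j * x ⟨j⟩ := by
  rw [← Equiv.ulift.{u}.sum_comp]
  rfl

theorem matOp_liftedMatrixOp_isPositive_iff {J : Type} [Fintype J] [DecidableEq J] {n : ℕ}
    (Y : Matrix (Fin n) (Fin n) (Matrix J J ℂ)) :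
    (matOp (Y.map (liftedMatrixOp.{u} J))).IsPositive ↔
      (Matrix.comp _ _ _ _ _ Y).PosSemidef := by
  rw [matOp_isPositive_iff, posSemidef_iff_forall_sum_nonneg]
  have key : ∀ x : Fin n → EuclideanSpace ℂ (ULift.{u} J),
      ∑ i, ∑ j, inner ℂ (x i) (Y.map (liftedMatrixOp.{u} J) i j (x j)) =
      ∑ p : Fin n × J, ∑ q : Fin n × J, star (x p.1 ⟨p.2⟩) * Matrix.comp _ _ _ _ _ Y p q *
        x q.1 ⟨q.2⟩ := by
    intro x
    rw [Fintype.sum_prod_type]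
    refine Finset.sum_congr rfl fun i _ => ?_
    simp only [Fintype.sum_prod_type]
    rw [Finset.sum_comm]
    refine Finset.sum_congr rfl fun j _ => ?_
    rw [PiLp.inner_apply, ← Equiv.ulift.{u}.symm.sum_comp]
    refine Finset.sum_congr rfl fun a _ => ?_
    rw [Matrix.map_apply, liftedMatrixOp_apply, RCLike.inner_apply, mul_comm, Finset.mul_sum]
    refine Finset.sum_congr rfl fun b _ => ?_
    rw [← mul_assoc]
    rfl
  constructor
  · intro h x
    have h1 := h fun i => WithLp.toLp 2 fun a => x (i, a.down)
    rw [key] at h1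
    exact h1
  · intro h x
    rw [key]
    exact h fun p => x p.1 ⟨p.2⟩

variable {S T : Type u} [AddCommGroup S] [Module ℂ S] [StarAddMonoid S] [StarModule ℂ S]
  [OperatorSystem S] [AddCommGroup T] [Module ℂ T] [StarAddMonoid T] [StarModule ℂ T]
  [OperatorSystem T]

theorem dotMap_tmul {H : Type u} [NormedAddCommGroup H] [InnerProductSpace ℂ H]
    {V W : Type u} [AddCommGroup V] [Module ℂ V] [AddCommGroup W] [Module ℂ W]
    (φ : V →ₗ[ℂ] (H →L[ℂ] H)) (ψ : W →ₗ[ℂ] (H →L[ℂ] H)) (v : V) (w : W) :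
    dotMap φ ψ (v ⊗ₜ w) = φ v * ψ w := rfl

theorem spatialMap_tmul {H K : Type u} [NormedAddCommGroup H] [InnerProductSpace ℂ H]
    [NormedAddCommGroup K] [InnerProductSpace ℂ K]
    {V W : Type u} [AddCommGroup V] [Module ℂ V] [AddCommGroup W] [Module ℂ W]
    (φ : V →ₗ[ℂ] (H →L[ℂ] H)) (ψ : W →ₗ[ℂ] (K →L[ℂ] K)) (v : V) (w : W) :
    spatialMap φ ψ (v ⊗ₜ w) = (TensorProduct.mapL (φ v) (ψ w)).completion := rfl

/-- The maps `φ ⊗ 1` and `1 ⊗ ψ` into `M_k ⊗ M_m` are ucp with commuting ranges, and their product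
is `φ ⊗ ψ`. -/
theorem commCone_subset_minCone (n : ℕ) : commCone S T n ⊆ minCone S T n := by
  intro X hX k m φ ψ hφ hψ
  let op := liftedMatrixOp.{u} (Fin k × Fin m)
  let Φ : S →ₗ[ℂ] _ := op.toLinearMap ∘ₗ
    (Matrix.kroneckerBilinear (R := ℂ)).flip (1 : Matrix (Fin m) (Fin m) ℂ) ∘ₗ φ
  let Ψ : T →ₗ[ℂ] _ := op.toLinearMap ∘ₗ
    Matrix.kroneckerBilinear (R := ℂ) (1 : Matrix (Fin k) (Fin k) ℂ) ∘ₗ ψ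
  have hΦ : ∀ s, Φ s = op (Matrix.kronecker (φ s) 1) := fun s => rfl
  have hΨ : ∀ t, Ψ t = op (Matrix.kronecker 1 (ψ t)) := fun t => rfl
  have uΦ : IsUCP Φ := by
    refine ⟨?_, fun N Z hZ => ?_⟩
    · rw [hΦ, hφ.1, Matrix.kronecker, Matrix.one_kronecker_one, map_one]
    · have e : Z.map Φ = (Z.map fun s => Matrix.kronecker (φ s) 1).map op := rfl
      rw [e, matOp_liftedMatrixOp_isPositive_iff]
      -- A Kronecker product of positive semidefinite matrices is positive semidefinite; `submatrix`
      -- merely reassociates the indices.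
      have h1 := ((hφ.2 N Z hZ).kronecker (Matrix.PosSemidef.one (n := Fin m) (R := ℂ))).submatrix
        (fun p : Fin N × Fin k × Fin m => ((p.1, p.2.1), p.2.2))
      exact h1
  have uΨ : IsUCP Ψ := by
    refine ⟨?_, fun N Z hZ => ?_⟩
    · rw [hΨ, hψ.1, Matrix.kronecker, Matrix.one_kronecker_one, map_one]
    · have e : Z.map Ψ = (Z.map fun s => Matrix.kronecker 1 (ψ s)).map op := rfl
      rw [e, matOp_liftedMatrixOp_isPositive_iff]
      have h1 := ((Matrix.PosSemidef.one (n := Fin k) (R := ℂ)).kronecker (hψ.2 N Z hZ)).submatrix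
        (fun p : Fin N × Fin k × Fin m => (p.2.1, (p.1, p.2.2)))
      exact h1
  have mul1 : ∀ s t, Φ s * Ψ t = op (Matrix.kronecker (φ s) (ψ t)) := by
    intro s t
    rw [hΦ, hΨ, ← map_mul, Matrix.kronecker, ← Matrix.mul_kronecker_mul, mul_one,
      one_mul]
  have mul2 : ∀ s t, Ψ t * Φ s = op (Matrix.kronecker (φ s) (ψ t)) := by
    intro s t
    rw [hΦ, hΨ, ← map_mul, Matrix.kronecker, ← Matrix.mul_kronecker_mul, mul_one,
      one_mul]
  have hdot : dotMap Φ Ψ = op.toLinearMap ∘ₗ kronMap φ ψ :=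
    TensorProduct.ext' fun s t => mul1 s t
  have h := hX _ Φ Ψ uΦ uΨ fun s t => (mul1 s t).trans (mul2 s t).symm
  rw [hdot] at h
  exact (matOp_liftedMatrixOp_isPositive_iff _).1 h

/-- The compression of a map into `B(H)` to the span of a finite family of vectors. -/
def compression {V : Type u} [AddCommGroup V] [Module ℂ V] {H : Type u} [NormedAddCommGroup H]
    [InnerProductSpace ℂ H] {k : ℕ} (φ : V →ₗ[ℂ] (H →L[ℂ] H)) (f : Fin k → H) :
    V →ₗ[ℂ] Matrix (Fin k) (Fin k) ℂ where
  toFun v := Matrix.of fun a b => inner ℂ (f a) (φ v (f b))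
  map_add' v w := by ext; simp
  map_smul' c v := by ext; simp

/-- Positivity is the form of `φ` tested on the vectors `∑ₐ x(i, a) fₐ`; orthonormality serves only
to make the compression unital. -/
theorem IsUCP.isMatrixUCP_compression {H : Type u} [NormedAddCommGroup H] [InnerProductSpace ℂ H]
    {φ : S →ₗ[ℂ] (H →L[ℂ] H)} (hφ : IsUCP φ) {k : ℕ} {f : Fin k → H} (hf : Orthonormal ℂ f) :
    IsMatrixUCP (compression φ f) := by
  refine ⟨?_, fun n X hX => ?_⟩
  · ext a b
    simp [compression, hφ.1, orthonormal_iff_ite.1 hf, Matrix.one_apply]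
  · rw [posSemidef_iff_forall_sum_nonneg]
    intro x
    have h := (matOp_isPositive_iff _).1 (hφ.2 n X hX) fun i => ∑ a, x (i, a) • f a
    convert h using 1
    rw [Fintype.sum_prod_type]
    refine Finset.sum_congr rfl fun i _ => ?_
    simp only [Fintype.sum_prod_type]
    rw [Finset.sum_comm]
    refine Finset.sum_congr rfl fun j _ => ?_
    rw [sum_inner]
    refine Finset.sum_congr rfl fun a _ => ?_
    rw [map_sum, inner_sum]
    refine Finset.sum_congr rfl fun b _ => ?_
    rw [map_smul, inner_smul_left, inner_smul_right]
    simp only [Matrix.comp_apply, Matrix.map_apply, compression, LinearMap.coe_mk,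
      AddHom.coe_mk, Matrix.of_apply, RCLike.star_def]
    ring

/-- Finitely many tensors lie in the span of the products of two finite orthonormal families. -/
theorem exists_orthonormal_sum_tmul {H K : Type u} [NormedAddCommGroup H] [InnerProductSpace ℂ H]
    [NormedAddCommGroup K] [InnerProductSpace ℂ K] {n : ℕ} (v : Fin n → H ⊗[ℂ] K) :
    ∃ (k m : ℕ) (f : Fin k → H) (g : Fin m → K) (c : Fin n → Fin k × Fin m → ℂ),
      Orthonormal ℂ f ∧ Orthonormal ℂ g ∧ ∀ i, v i = ∑ p, c i p • f p.1 ⊗ₜ[ℂ] g p.2 := by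
  obtain ⟨F, G, _, _, h⟩ := TensorProduct.exists_finite_submodule_of_setFinite
    (Set.range v) (Set.finite_range v)
  let f := stdOrthonormalBasis ℂ F
  let g := stdOrthonormalBasis ℂ G
  have h1 : ∀ i, ∃ c : Fin (Module.finrank ℂ F) × Fin (Module.finrank ℂ G) → ℂ,
      v i = ∑ p, c p • (f p.1 : H) ⊗ₜ[ℂ] (g p.2 : K) := by
    intro i
    obtain ⟨x, hx⟩ := h (Set.mem_range_self i)
    refine ⟨fun p => (f.toBasis.tensorProduct g.toBasis).repr x p, ?_⟩
    rw [← hx]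
    conv_lhs => rw [← (f.toBasis.tensorProduct g.toBasis).sum_repr x]
    simp [map_sum, Module.Basis.tensorProduct_apply', TensorProduct.mapIncl]
  choose c hc using h1
  exact ⟨_, _, fun a => f a, fun b => g b, c, f.orthonormal.comp_linearIsometry F.subtypeₗᵢ,
    g.orthonormal.comp_linearIsometry G.subtypeₗᵢ, hc⟩

/-- Inner products of elementary tensors factor, so compressing a spatial map to product vectors
gives the Kronecker product of the compressions. This links the minimal cone, defined through
matrices, with operators on `H ⊗ K`. -/
theorem inner_spatialMap_tmul {H K : Type u} [NormedAddCommGroup H] [InnerProductSpace ℂ H]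
    [NormedAddCommGroup K] [InnerProductSpace ℂ K]
    {V W : Type u} [AddCommGroup V] [Module ℂ V] [AddCommGroup W] [Module ℂ W]
    (φ : V →ₗ[ℂ] (H →L[ℂ] H)) (ψ : W →ₗ[ℂ] (K →L[ℂ] K)) {k m : ℕ} (f : Fin k → H) (g : Fin m → K)
    (z : V ⊗[ℂ] W) (p q : Fin k × Fin m) :
    inner ℂ ((f p.1 ⊗ₜ[ℂ] g p.2 : H ⊗[ℂ] K) : HilbertTensor H K)
      (spatialMap φ ψ z ((f q.1 ⊗ₜ[ℂ] g q.2 : H ⊗[ℂ] K) : HilbertTensor H K)) =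
      kronMap (compression φ f) (compression ψ g) z p q := by
  induction z with
  | zero => simp
  | add z w hz hw => simp [inner_add_right, hz, hw]
  | tmul v w =>
    rw [spatialMap_tmul, ContinuousLinearMap.completion_apply_coe,
      UniformSpace.Completion.inner_coe, TensorProduct.mapL_tmul, TensorProduct.inner_tmul]
    rfl

/-- Elements of the minimal cone are positive in every spatial representation. -/
theorem isPositive_matOp_spatialMap_of_mem_minCone {H K : Type u}
    [NormedAddCommGroup H] [InnerProductSpace ℂ H] [NormedAddCommGroup K] [InnerProductSpace ℂ K]
    {φ : S →ₗ[ℂ] (H →L[ℂ] H)} {ψ : T →ₗ[ℂ] (K →L[ℂ] K)} (hφ : IsUCP φ) (hψ : IsUCP ψ) {n : ℕ}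
    {X : Matrix (Fin n) (Fin n) (S ⊗[ℂ] T)} (hX : X ∈ minCone S T n) :
    (matOp (X.map (spatialMap φ ψ))).IsPositive := by
  rw [matOp_isPositive_iff]
  intro v
  have hd : DenseRange (Pi.map fun (_ : Fin n) (x : H ⊗[ℂ] K) => (x : HilbertTensor H K)) :=
    DenseRange.piMap fun _ => UniformSpace.Completion.denseRange_coe
  refine hd.induction_on (p := fun v => 0 ≤ ∑ i, ∑ j,
    inner ℂ (v i) (X.map (spatialMap φ ψ) i j (v j))) v ?_ fun w => ?_
  · exact isClosed_le (by fun_prop) (by fun_prop)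
  -- Only finitely many legs occur in `w`, so the form is that of a pair of matrix-valued ucp
  -- compressions, where membership in the minimal cone applies.
  · obtain ⟨k, m, f, g, c, hf, hg, hc⟩ := exists_orthonormal_sum_tmul w
    have h := (posSemidef_iff_forall_sum_nonneg _).1 (hX k m _ _ (hφ.isMatrixUCP_compression hf)
      (hψ.isMatrixUCP_compression hg)) fun p => c p.1 p.2
    have hw : ∀ i, (w i : HilbertTensor H K) =
        ∑ p, c i p • ((f p.1 ⊗ₜ[ℂ] g p.2 : H ⊗[ℂ] K) : HilbertTensor H K) := by
      intro i
      rw [hc, ← UniformSpace.Completion.coe_toComplL (𝕜 := ℂ), map_sum]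
      simp
    convert h using 1
    rw [Fintype.sum_prod_type]
    refine Finset.sum_congr rfl fun i _ => ?_
    simp only [Fintype.sum_prod_type (α₁ := Fin n), Pi.map_apply, hw]
    rw [Finset.sum_comm]
    refine Finset.sum_congr rfl fun j _ => ?_
    rw [sum_inner]
    refine Finset.sum_congr rfl fun a _ => ?_
    rw [map_sum, inner_sum]
    refine Finset.sum_congr rfl fun b _ => ?_
    rw [map_smul, inner_smul_left, inner_smul_right, Matrix.map_apply, inner_spatialMap_tmul,
      Matrix.comp_apply, Matrix.map_apply]
    simp only [RCLike.star_def]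
    ring

end Cones

/-! ### Representations of C⋆-algebras -/

section Representations

variable {D : Type u} [CStarAlgebra D] {K L : Type u} [NormedAddCommGroup K]
  [InnerProductSpace ℂ K] [CompleteSpace K] [NormedAddCommGroup L] [InnerProductSpace ℂ L]
  [CompleteSpace L]

/-- The amplification `M_n(D) → B(K^n)` of a representation of `D` on `K`. -/
def matOpRep (ρ : D →⋆ₐ[ℂ] (K →L[ℂ] K)) (n : ℕ) :
    CStarMatrix (Fin n) (Fin n) D →⋆ₙₐ[ℂ]
      (PiLp 2 (fun _ : Fin n => K) →L[ℂ] PiLp 2 (fun _ : Fin n => K)) where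
  toFun X := matOp ((CStarMatrix.ofMatrix.symm X).map ρ)
  map_smul' c X := by
    rw [MonoidHom.id_apply, ← matOp_smul]
    congr 1
    ext1 i j
    exact map_smul ρ c (X i j)
  map_zero' := by
    ext v i
    simp [matOp_apply, CStarMatrix.ofMatrix_symm_apply]
  map_add' X Y := by
    rw [← matOp_add]
    congr 1
    ext1 i j
    exact map_add ρ (X i j) (Y i j)
  map_mul' X Y := by
    rw [← matOp_mul, ← Matrix.map_mul]
    rfl
  map_star' X := by
    rw [← matOp_conjTranspose]
    congr 1
    ext1 i j
    exact map_star ρ (X j i)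

/-- An amplified representation is a star homomorphism of the C⋆-algebra `M_n(D)`: always
contractive, and isometric when injective. -/
theorem norm_matOp_map_le_of_injective (ρ : D →⋆ₐ[ℂ] (K →L[ℂ] K))
    (hρ : Function.Injective ρ) (π : D →⋆ₐ[ℂ] (L →L[ℂ] L)) {n : ℕ}
    (X : Matrix (Fin n) (Fin n) D) : ‖matOp (X.map π)‖ ≤ ‖matOp (X.map ρ)‖ := by
  let _ := CStarAlgebra.spectralOrder D
  have _ := CStarAlgebra.spectralOrderedRing D
  have hinj : Function.Injective (matOpRep ρ n) := by
    intro Y Z h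
    refine CStarMatrix.ext fun i j => hρ ?_
    exact congrFun (congrFun (matOp_injective h) i) j
  have h1 := NonUnitalStarAlgHom.norm_apply_le (matOpRep π n) (CStarMatrix.ofMatrix X)
  have h2 := NonUnitalStarAlgHom.norm_map (matOpRep ρ n) hinj (CStarMatrix.ofMatrix X)
  exact h1.trans h2.ge

theorem isUCP_of_starAlgHom (ρ : D →⋆ₐ[ℂ] (K →L[ℂ] K)) :
    IsUCP ρ.toAlgHom.toLinearMap := by
  refine ⟨map_one ρ, ?_⟩
  rintro n _ ⟨Y, rfl⟩
  have h : matOp ((Y.conjTranspose * Y).map ρ) =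
      star (matOp (Y.map ρ)) * matOp (Y.map ρ) := by
    rw [← matOp_conjTranspose, ← matOp_mul, Matrix.map_mul]
    congr 2
    ext1 i j
    exact map_star ρ (Y j i)
  change (matOp ((Y.conjTranspose * Y).map ρ)).IsPositive
  rw [h]
  exact ContinuousLinearMap.isPositive_adjoint_comp_self _

/-- The representation `π ⊕ π` of `D` on `K²`. -/
def diagonalRep (π : D →⋆ₐ[ℂ] (K →L[ℂ] K)) :
    D →⋆ₐ[ℂ] (PiLp 2 (fun _ : Fin 2 => K) →L[ℂ] PiLp 2 (fun _ : Fin 2 => K)) where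
  toFun d := matOp (Matrix.diagonal fun _ => π d)
  map_one' := by simp [matOp_one]
  map_mul' a b := by simp [← matOp_mul]
  map_zero' := by
    ext v i
    simp [matOp_apply]
  map_add' a b := by simp [← matOp_add]
  commutes' c := by
    rw [AlgHomClass.commutes, Algebra.algebraMap_eq_smul_one, Algebra.algebraMap_eq_smul_one,
      ← matOp_one, ← matOp_smul]
    congr 1
    ext1 i j
    by_cases h : i = j
    · subst h; simp
    · simp [h]
  map_star' a := by
    rw [← matOp_conjTranspose, Matrix.diagonal_conjTranspose]
    congr 2
    ext1 i
    exact map_star π a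

end Representations

/-! ### Block matrices of operators -/

section Blocks

variable {H : Type u} [NormedAddCommGroup H] [InnerProductSpace ℂ H]

/-- Flattening `M_n(M_m(B(H)))` to `M_{nm}(B(H))` is isometric: both norms are suprema of the same
double sums. It reduces norms over `U(S)` to norms over `S`. -/
theorem norm_matOp_map_matOp {n m : ℕ}
    (Z : Matrix (Fin n) (Fin n) (Matrix (Fin m) (Fin m) (H →L[ℂ] H))) :
    ‖matOp (Z.map matOp)‖ =
      ‖matOp ((Matrix.comp _ _ _ _ _ Z).reindex finProdFinEquiv finProdFinEquiv)‖ := by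
  refine eq_of_forall_ge_iff fun C => ?_
  by_cases hC : 0 ≤ C
  swap
  · exact iff_of_false (fun h => hC ((ContinuousLinearMap.opNorm_nonneg _).trans h))
      fun h => hC ((ContinuousLinearMap.opNorm_nonneg _).trans h)
  rw [norm_matOp_le_iff _ hC, norm_matOp_le_iff _ hC]
  have e1 : ∀ v : Fin n → PiLp 2 (fun _ : Fin m => H),
      ∑ i, ‖∑ j, Z.map matOp i j (v j)‖ ^ 2 =
        ∑ p : Fin n × Fin m, ‖∑ q : Fin n × Fin m, Z p.1 q.1 p.2 q.2 (v q.1 q.2)‖ ^ 2 := by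
    intro v
    simp only [Fintype.sum_prod_type]
    refine Finset.sum_congr rfl fun i _ => ?_
    rw [PiLp.norm_sq_eq_of_L2]
    simp [matOp_apply]
  have e2 : ∀ v : Fin n → PiLp 2 (fun _ : Fin m => H),
      ∑ i, ‖v i‖ ^ 2 = ∑ p : Fin n × Fin m, ‖v p.1 p.2‖ ^ 2 := by
    intro v
    rw [Fintype.sum_prod_type]
    exact Finset.sum_congr rfl fun i _ => PiLp.norm_sq_eq_of_L2 _ _
  have e3 : ∀ w : Fin (n * m) → H, ∑ i, ‖∑ j, (Matrix.comp _ _ _ _ _ Z).reindex finProdFinEquiv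
      finProdFinEquiv i j (w j)‖ ^ 2 = ∑ p : Fin n × Fin m, ‖∑ q : Fin n × Fin m,
        Z p.1 q.1 p.2 q.2 (w (finProdFinEquiv q))‖ ^ 2 := by
    intro w
    rw [← finProdFinEquiv.sum_comp]
    refine Finset.sum_congr rfl fun p _ => ?_
    rw [← finProdFinEquiv.sum_comp]
    simp only [Matrix.reindex_apply, Matrix.submatrix_apply, Equiv.symm_apply_apply,
      Matrix.comp_apply]
  have e4 : ∀ w : Fin (n * m) → H, ∑ i, ‖w i‖ ^ 2 =
      ∑ p : Fin n × Fin m, ‖w (finProdFinEquiv p)‖ ^ 2 := by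
    intro w
    rw [← finProdFinEquiv.sum_comp]
  constructor
  · intro h w
    have h1 := h fun i => WithLp.toLp 2 fun a => w (finProdFinEquiv (i, a))
    rw [e1, e2] at h1
    rw [e3, e4]
    exact h1
  · intro h v
    have h1 := h fun p => v (finProdFinEquiv.symm p).1 (finProdFinEquiv.symm p).2
    rw [e3, e4] at h1
    simp only [Equiv.symm_apply_apply] at h1
    rw [e1, e2]
    exact h1

/-- The inclusion of `H` as the `j`-th coordinate subspace of `H²`. -/
def coordIn (H : Type u) [NormedAddCommGroup H] [InnerProductSpace ℂ H] (j : Fin 2) :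
    H →L[ℂ] PiLp 2 (fun _ : Fin 2 => H) :=
  LinearMap.mkContinuous
    { toFun := fun x => PiLp.single 2 j x
      map_add' := fun x y => PiLp.single_add 2 j
      map_smul' := fun c x => by
        ext i
        by_cases h : i = j
        · subst h; simp
        · simp [h] } 1 fun x => by simp

theorem coordIn_apply (j : Fin 2) (x : H) : coordIn H j x = PiLp.single 2 j x := rfl

theorem norm_coordIn_le (j : Fin 2) : ‖coordIn H j‖ ≤ 1 :=
  LinearMap.mkContinuous_norm_le _ zero_le_one _

theorem norm_proj_le (i : Fin 2) :
    ‖(PiLp.proj 2 (fun _ : Fin 2 => H) i : PiLp 2 (fun _ : Fin 2 => H) →L[ℂ] H)‖ ≤ 1 :=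
  ContinuousLinearMap.opNorm_le_bound _ zero_le_one fun x => by
    simpa using PiLp.norm_apply_le x i

theorem upperOp_apply_zero (c : ℂ) (x : H →L[ℂ] H) (v : PiLp 2 (fun _ : Fin 2 => H)) :
    upperOp c x v 0 = c • v 0 + x (v 1) := by
  simp [upperOp, matOp_apply, Fin.sum_univ_two]

theorem upperOp_apply_one (c : ℂ) (x : H →L[ℂ] H) (v : PiLp 2 (fun _ : Fin 2 => H)) :
    upperOp c x v 1 = c • v 1 := by
  simp [upperOp, matOp_apply, Fin.sum_univ_two]

theorem upperOp_mul (c d : ℂ) (x y : H →L[ℂ] H) :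
    upperOp c x * upperOp d y = upperOp (c * d) (c • y + d • x) := by
  ext v i
  fin_cases i
  · simp [upperOp_apply_zero, upperOp_apply_one, mul_smul, add_assoc]
  · simp [upperOp_apply_one, mul_smul]

/-- The corner embedding is composition with two contractions, so it cannot increase norms, even
after tensoring with the identity of `K`. -/
theorem upperOp_zero_eq (x : H →L[ℂ] H) :
    upperOp 0 x = coordIn H 0 ∘L x ∘L PiLp.proj 2 (fun _ : Fin 2 => H) 1 := by
  ext v i
  fin_cases i
  · simp [upperOp_apply_zero, coordIn_apply]
  · simp [upperOp_apply_one, coordIn_apply]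

end Blocks

/-! ### Representations of `U(S)` -/

section Upper

variable {S : Type u} [AddCommGroup S] [Module ℂ S] {H L : Type u} [NormedAddCommGroup H]
  [InnerProductSpace ℂ H] [NormedAddCommGroup L] [InnerProductSpace ℂ L]
  {ι : S →ₗ[ℂ] (H →L[ℂ] H)}

/-- The map `M_2(S) → B(L²)` induced by a linear map `S → B(L)`. -/
def matOpMap (φ : S →ₗ[ℂ] (L →L[ℂ] L)) : Matrix (Fin 2) (Fin 2) S →ₗ[ℂ]
    (PiLp 2 (fun _ : Fin 2 => L) →L[ℂ] PiLp 2 (fun _ : Fin 2 => L)) where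
  toFun Y := matOp (Y.map φ)
  map_add' Y Z := by
    rw [← matOp_add]
    congr 1
    ext1 i j
    simp
  map_smul' c Y := by
    rw [RingHom.id_apply, ← matOp_smul]
    congr 1
    ext1 i j
    simp

theorem exists_eq_upperOp (T : upperAlgebra (LinearMap.range ι)) : ∃ (c : ℂ) (s : S),
    (T : PiLp 2 (fun _ : Fin 2 => H) →L[ℂ] PiLp 2 (fun _ : Fin 2 => H)) = upperOp c (ι s) := by
  obtain ⟨_, c, _, ⟨s, rfl⟩, rfl⟩ := T
  exact ⟨c, s, rfl⟩

/-- The embedding `s ↦ [[0, ι s], [0, 0]]` of `S` into `U(S)`. -/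
def upperCorner (ι : S →ₗ[ℂ] (H →L[ℂ] H)) : S →ₗ[ℂ] upperAlgebra (LinearMap.range ι) where
  toFun s := ⟨upperOp 0 (ι s), 0, ι s, ⟨s, rfl⟩, rfl⟩
  map_add' s t := by
    refine Subtype.ext ?_
    simp [upperOp_zero_eq, ContinuousLinearMap.comp_add, ContinuousLinearMap.add_comp]
  map_smul' c s := by
    refine Subtype.ext ?_
    simp [upperOp_zero_eq]

theorem coe_upperCorner (s : S) : (upperCorner ι s :
    PiLp 2 (fun _ : Fin 2 => H) →L[ℂ] PiLp 2 (fun _ : Fin 2 => H)) = upperOp 0 (ι s) := rfl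

variable [StarAddMonoid S] [StarModule ℂ S] [OperatorSystem S]

/-- Writing the scalar `c` as `c • unit` places `U(S)` inside `M_2(S)`; a unital `φ` applied
entrywise then preserves the triangular shape and the diagonal. -/
theorem matOpMap_upper {φ : S →ₗ[ℂ] (L →L[ℂ] L)} (hφ : φ OperatorSystem.unit = 1) (c : ℂ) (s : S) :
    matOpMap φ !![c • OperatorSystem.unit, s; 0, c • OperatorSystem.unit] = upperOp c (φ s) := by
  change matOp _ = matOp _
  congr 1
  ext1 i j
  fin_cases i <;> fin_cases j <;> simp [hφ]

theorem matOpMap_injective (hι : IsCompleteOrderEmbedding ι) :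
    Function.Injective (matOpMap ι) := by
  intro Y Z h
  ext i j
  exact hι.injective (congrFun (congrFun (matOp_injective h) i) j)

theorem upperAlgebra_le_range (hι : IsCompleteOrderEmbedding ι) :
    Subalgebra.toSubmodule (upperAlgebra (LinearMap.range ι)) ≤ LinearMap.range (matOpMap ι) := by
  rintro _ ⟨c, _, ⟨s, rfl⟩, rfl⟩
  exact ⟨_, matOpMap_upper hι.1 c s⟩

variable (hι : IsCompleteOrderEmbedding ι)

/-- The entries of an element of `U(S)`, as elements of `S`. -/
def upperEntries : upperAlgebra (LinearMap.range ι) →ₗ[ℂ] Matrix (Fin 2) (Fin 2) S :=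
  (LinearEquiv.ofInjective (matOpMap ι) (matOpMap_injective hι)).symm.toLinearMap ∘ₗ
    Submodule.inclusion (upperAlgebra_le_range hι)

theorem matOpMap_upperEntries (T : upperAlgebra (LinearMap.range ι)) :
    matOpMap ι (upperEntries hι T) = T := by
  have h := (LinearEquiv.ofInjective (matOpMap ι) (matOpMap_injective hι)).apply_symm_apply
    (Submodule.inclusion (upperAlgebra_le_range hι) T)
  exact congrArg Subtype.val h

theorem upperEntries_eq {T : upperAlgebra (LinearMap.range ι)} {c : ℂ} {s : S}
    (hT : (T : PiLp 2 (fun _ : Fin 2 => H) →L[ℂ] PiLp 2 (fun _ : Fin 2 => H)) =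
      upperOp c (ι s)) :
    upperEntries hι T = !![c • OperatorSystem.unit, s; 0, c • OperatorSystem.unit] := by
  apply matOpMap_injective hι
  rw [matOpMap_upperEntries, matOpMap_upper hι.1, hT]

theorem matOpMap_upperEntries_eq {φ : S →ₗ[ℂ] (L →L[ℂ] L)} (hφ : φ OperatorSystem.unit = 1)
    {T : upperAlgebra (LinearMap.range ι)} {c : ℂ} {s : S}
    (hT : (T : PiLp 2 (fun _ : Fin 2 => H) →L[ℂ] PiLp 2 (fun _ : Fin 2 => H)) =
      upperOp c (ι s)) :
    matOpMap φ (upperEntries hι T) = upperOp c (φ s) := by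
  rw [upperEntries_eq hι hT, matOpMap_upper hφ]

/-- The representation `[[c, ι s], [0, c]] ↦ [[c, φ s], [0, c]]` of `U(S)` on `L²`. -/
def upperRep (φ : S →ₗ[ℂ] (L →L[ℂ] L)) (hφ : φ OperatorSystem.unit = 1) :
    upperAlgebra (LinearMap.range ι) →ₙₐ[ℂ]
      (PiLp 2 (fun _ : Fin 2 => L) →L[ℂ] PiLp 2 (fun _ : Fin 2 => L)) where
  toFun T := matOpMap φ (upperEntries hι T)
  map_smul' c T := by simp
  map_zero' := by simp
  map_add' T T' := by simp
  map_mul' T T' := by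
    obtain ⟨c, s, h⟩ := exists_eq_upperOp T
    obtain ⟨d, t, h'⟩ := exists_eq_upperOp T'
    -- The off-diagonal entry of a product is a scalar combination of `s` and `t`, so linearity of
    -- `φ` suffices for multiplicativity.
    have hmul : ((T * T' : upperAlgebra (LinearMap.range ι)) :
        PiLp 2 (fun _ : Fin 2 => H) →L[ℂ] PiLp 2 (fun _ : Fin 2 => H)) =
        upperOp (c * d) (ι (c • t + d • s)) := by
      rw [MulMemClass.coe_mul, h, h', upperOp_mul, map_add, map_smul, map_smul]
    rw [matOpMap_upperEntries_eq hι hφ h, matOpMap_upperEntries_eq hι hφ h',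
      matOpMap_upperEntries_eq hι hφ hmul, upperOp_mul, map_add, map_smul, map_smul]

theorem upperRep_eq {φ : S →ₗ[ℂ] (L →L[ℂ] L)} (hφ : φ OperatorSystem.unit = 1)
    {T : upperAlgebra (LinearMap.range ι)} {c : ℂ} {s : S}
    (hT : (T : PiLp 2 (fun _ : Fin 2 => H) →L[ℂ] PiLp 2 (fun _ : Fin 2 => H)) =
      upperOp c (ι s)) : upperRep hι φ hφ T = upperOp c (φ s) :=
  matOpMap_upperEntries_eq hι hφ hT

/-- The representation is the restriction of the entrywise amplification of `φ` to `M_2(S)`, so its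
norm at level `n` is that of `φ` at level `n * 2`. -/
theorem isCompletelyContractive_upperRep (φ : S →ₗ[ℂ] (L →L[ℂ] L))
    (hφ : φ OperatorSystem.unit = 1)
    (hφι : ∀ (n : ℕ) (X : Matrix (Fin n) (Fin n) S), ‖matOp (X.map φ)‖ ≤ ‖matOp (X.map ι)‖) :
    IsCompletelyContractive (upperAlgebra (LinearMap.range ι)).val (upperRep hι φ hφ) := by
  intro n X
  let Y : Matrix (Fin n) (Fin n) (Matrix (Fin 2) (Fin 2) S) := X.map (upperEntries hι)
  have e : ∀ (E : Type u) [NormedAddCommGroup E] [InnerProductSpace ℂ E]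
      (θ : S →ₗ[ℂ] (E →L[ℂ] E)), ‖matOp (Y.map (matOpMap θ))‖ =
      ‖matOp (((Matrix.comp _ _ _ _ _ Y).reindex finProdFinEquiv finProdFinEquiv).map θ)‖ := by
    intro E _ _ θ
    exact norm_matOp_map_matOp (Y.map fun M => M.map θ)
  have e1 : X.map (upperRep hι φ hφ) = Y.map (matOpMap φ) := rfl
  have e2 : X.map (upperAlgebra (LinearMap.range ι)).val = Y.map (matOpMap ι) := by
    ext1 i j
    exact (matOpMap_upperEntries hι (X i j)).symm
  rw [e1, e2, e, e]
  exact hφι _ _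

end Upper

/-! ### Comparison of the tensor norms -/

section Comparison

theorem norm_completion_le_one {E F : Type u} [NormedAddCommGroup E] [NormedSpace ℂ E]
    [NormedAddCommGroup F] [NormedSpace ℂ F] (f : E →L[ℂ] F) (hf : ‖f‖ ≤ 1) :
    ‖f.completion‖ ≤ 1 := by
  refine ContinuousLinearMap.opNorm_le_bound _ zero_le_one fun x => ?_
  induction x using UniformSpace.Completion.induction_on with
  | hp => exact isClosed_le (by fun_prop) (by fun_prop)
  | ih x => simpa using f.le_of_opNorm_le hf x

/-- If `f` is a compression of `g` by contractions, then the amplifications of `f` are dominated by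
those of `g`. -/
theorem enorm_matOp_map_le_of_eq_conj {V E F : Type u} [NormedAddCommGroup E]
    [InnerProductSpace ℂ E] [NormedAddCommGroup F] [InnerProductSpace ℂ F] {f : V → (E →L[ℂ] E)}
    {g : V → (F →L[ℂ] F)} (a : F →L[ℂ] E) (b : E →L[ℂ] F) (ha : ‖a‖ ≤ 1) (hb : ‖b‖ ≤ 1)
    (h : ∀ z, f z = a ∘L g z ∘L b) {n : ℕ} (X : Matrix (Fin n) (Fin n) V) :
    ‖matOp (X.map f)‖ₑ ≤ ‖matOp (X.map g)‖ₑ := by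
  have e : X.map f = (X.map g).map fun T => a ∘L T ∘L b := by
    ext1 i j
    exact h (X i j)
  rw [e, enorm_le_iff_norm_le]
  exact norm_matOp_conj_le a b ha hb _

theorem norm_completion_mapL_one_le {E F K : Type u} [NormedAddCommGroup E]
    [InnerProductSpace ℂ E] [NormedAddCommGroup F] [InnerProductSpace ℂ F] [NormedAddCommGroup K]
    [InnerProductSpace ℂ K] (f : E →L[ℂ] F) (hf : ‖f‖ ≤ 1) :
    ‖(TensorProduct.mapL f (1 : K →L[ℂ] K)).completion‖ ≤ 1 :=
  norm_completion_le_one _ ((TensorProduct.norm_mapL_le _ _).trans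
    (mul_le_one₀ hf (norm_nonneg _) ContinuousLinearMap.norm_id_le))

variable {S D A : Type u} [AddCommGroup S] [Module ℂ S] [Ring A] [Algebra ℂ A]
  {H K L : Type u} [NormedAddCommGroup H] [InnerProductSpace ℂ H]
  [NormedAddCommGroup K] [InnerProductSpace ℂ K] [NormedAddCommGroup L] [InnerProductSpace ℂ L]
  {κ : S →ₗ[ℂ] A}
  {j : A →ₐ[ℂ] (PiLp 2 (fun _ : Fin 2 => H) →L[ℂ] PiLp 2 (fun _ : Fin 2 => H))}

theorem spatialMap_rTensor_corner [AddCommGroup D] [Module ℂ D] {ι : S →ₗ[ℂ] (H →L[ℂ] H)}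
    (hκ : ∀ s, j (κ s) = upperOp 0 (ι s)) (ρ : D →ₗ[ℂ] (K →L[ℂ] K)) (z : S ⊗[ℂ] D) :
    spatialMap j.toLinearMap ρ (κ.rTensor D z) =
      (TensorProduct.mapL (coordIn H 0) (1 : K →L[ℂ] K)).completion ∘L spatialMap ι ρ z ∘L
        (TensorProduct.mapL (PiLp.proj 2 (fun _ : Fin 2 => H) 1 : _ →L[ℂ] H)
          (1 : K →L[ℂ] K)).completion := by
  induction z with
  | zero => simp
  | add z w hz hw =>
    rw [map_add, map_add, map_add, hz, hw, ContinuousLinearMap.add_comp,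
      ContinuousLinearMap.comp_add]
  | tmul s d =>
    have e : TensorProduct.mapL (j.toLinearMap (κ s)) (ρ d) =
        TensorProduct.mapL (coordIn H 0) (1 : K →L[ℂ] K) ∘L TensorProduct.mapL (ι s) (ρ d) ∘L
        TensorProduct.mapL (PiLp.proj 2 (fun _ : Fin 2 => H) 1 : _ →L[ℂ] H)
          (1 : K →L[ℂ] K) := by
      rw [← TensorProduct.mapL_comp, ← TensorProduct.mapL_comp, ← upperOp_zero_eq, ← hκ]
      rfl
    rw [LinearMap.rTensor_tmul, spatialMap_tmul, spatialMap_tmul, e]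
    ext x
    induction x using UniformSpace.Completion.induction_on with
    | hp => exact isClosed_eq (ContinuousLinearMap.continuous _) (ContinuousLinearMap.continuous _)
    | ih x => simp only [ContinuousLinearMap.comp_apply, ContinuousLinearMap.completion_apply_coe]

/-- The minimal norm on the corner of `U(S) ⊗ D` is dominated by the spatial norm of `S ⊗ D`. -/
theorem algMinNorm_rTensor_corner_le [Ring D] [Algebra ℂ D] {ι : S →ₗ[ℂ] (H →L[ℂ] H)}
    (hκ : ∀ s, j (κ s) = upperOp 0 (ι s)) (ρ : D →ₐ[ℂ] (K →L[ℂ] K)) {n : ℕ}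
    (X : Matrix (Fin n) (Fin n) (S ⊗[ℂ] D)) :
    algMinNorm j ρ (X.map (κ.rTensor D)) ≤ ‖matOp (X.map (spatialMap ι ρ.toLinearMap))‖ₑ := by
  have ha : ‖(TensorProduct.mapL (coordIn H 0) (1 : K →L[ℂ] K)).completion‖ ≤ 1 :=
    norm_completion_mapL_one_le (coordIn H 0) (norm_coordIn_le 0)
  have hb : ‖(TensorProduct.mapL (PiLp.proj 2 (fun _ : Fin 2 => H) 1 : _ →L[ℂ] H)
      (1 : K →L[ℂ] K)).completion‖ ≤ 1 :=
    norm_completion_mapL_one_le (PiLp.proj 2 (fun _ : Fin 2 => H) 1) (norm_proj_le 1)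
  exact enorm_matOp_map_le_of_eq_conj (f := fun z => spatialMap j.toLinearMap ρ.toLinearMap
    (κ.rTensor D z)) _ _ ha hb (spatialMap_rTensor_corner hκ ρ.toLinearMap) X

variable [CStarAlgebra D] [CompleteSpace K] [CompleteSpace L] {φ : S →ₗ[ℂ] (L →L[ℂ] L)}
  {π : D →⋆ₐ[ℂ] (L →L[ℂ] L)}

theorem commute_upperOp_diagonalRep (hφπ : ∀ s d, Commute (φ s) (π d)) (c : ℂ) (s : S) (d : D) :
    Commute (upperOp c (φ s)) (diagonalRep π d) := by
  change matOp _ * matOp _ = matOp _ * matOp _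
  rw [← matOp_mul, ← matOp_mul]
  congr 1
  ext1 i j
  rw [Matrix.mul_diagonal, Matrix.diagonal_mul]
  fin_cases i <;> fin_cases j <;> simp [(hφπ s d).eq]

/-- The `(0,1)` entry of `[[0, φ s], [0, 0]] (π d ⊕ π d)` is `φ(s) π(d)`. -/
theorem dotMap_rTensor_corner
    {σ : A →ₗ[ℂ] (PiLp 2 (fun _ : Fin 2 => L) →L[ℂ] PiLp 2 (fun _ : Fin 2 => L))}
    (hσ : ∀ s, σ (κ s) = upperOp 0 (φ s)) (z : S ⊗[ℂ] D) :
    (PiLp.proj 2 (fun _ : Fin 2 => L) 0 : _ →L[ℂ] L) ∘L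
      dotMap σ (diagonalRep π).toAlgHom.toLinearMap (κ.rTensor D z) ∘L coordIn L 1 =
      dotMap φ π.toAlgHom.toLinearMap z := by
  induction z with
  | zero => simp
  | add z w hz hw =>
    rw [map_add, map_add, map_add, ContinuousLinearMap.add_comp, ContinuousLinearMap.comp_add,
      hz, hw]
  | tmul s d =>
    rw [LinearMap.rTensor_tmul, dotMap_tmul, dotMap_tmul, hσ]
    ext x
    change upperOp 0 (φ s) (diagonalRep π d (coordIn L 1 x)) 0 = φ s (π d x)
    rw [upperOp_apply_zero]
    change (0 : ℂ) • _ + φ s (matOp (Matrix.diagonal fun _ => π d) (coordIn L 1 x) 1) = _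
    simp [matOp_apply, coordIn_apply, Fin.sum_univ_two]

/-- The maximal norm on the corner of `U(S) ⊗ D` dominates the norm of `φ · π`, where the
representation `σ` of `U(S)` extends `φ`. -/
theorem enorm_matOp_dotMap_le_algMaxNorm
    {σ : A →ₙₐ[ℂ] (PiLp 2 (fun _ : Fin 2 => L) →L[ℂ] PiLp 2 (fun _ : Fin 2 => L))}
    (hjσ : IsCompletelyContractive j σ) (hσ : ∀ a, ∃ c s, σ a = upperOp c (φ s))
    (hσκ : ∀ s, σ (κ s) = upperOp 0 (φ s)) (hφπ : ∀ s d, Commute (φ s) (π d))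
    {ρ : D →⋆ₐ[ℂ] (K →L[ℂ] K)} (hρ : Function.Injective ρ) {n : ℕ}
    (X : Matrix (Fin n) (Fin n) (S ⊗[ℂ] D)) :
    ‖matOp (X.map (dotMap φ π.toAlgHom.toLinearMap))‖ₑ ≤
      algMaxNorm j ρ.toAlgHom (X.map (κ.rTensor D)) := by
  let B := PiLp 2 (fun _ : Fin 2 => L) →L[ℂ] PiLp 2 (fun _ : Fin 2 => L)
  let τ : D →ₙₐ[ℂ] B := (diagonalRep π).toNonUnitalStarAlgHom.toNonUnitalAlgHom
  have h1 := enorm_matOp_map_le_of_eq_conj (f := dotMap φ π.toAlgHom.toLinearMap)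
    (g := fun z => dotMap (σ : A →ₗ[ℂ] B) (τ : D →ₗ[ℂ] B) (κ.rTensor D z))
    (PiLp.proj 2 (fun _ : Fin 2 => L) 0) (coordIn L 1) (norm_proj_le 0) (norm_coordIn_le 1)
    (fun z => (dotMap_rTensor_corner hσκ z).symm) X
  -- The pair `σ`, `π ⊕ π` is admissible in the supremum defining the maximal norm; the second
  -- member is completely contractive relative to `ρ` because `ρ` is faithful.
  refine h1.trans
    (le_sSup ⟨_, _, _, inferInstance, σ, τ, hjσ, fun N Z => ?_, fun a d => ?_, rfl⟩)
  · exact norm_matOp_map_le_of_injective ρ hρ (diagonalRep π) Z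
  · obtain ⟨c, s, h⟩ := hσ a
    rw [h]
    exact commute_upperOp_diagonalRep hφπ c s d

end Comparison

/-! ### From equality of tensor norms to equality of cones -/

section Main

variable {S : Type u} [AddCommGroup S] [Module ℂ S] [StarAddMonoid S] [StarModule ℂ S]
  [OperatorSystem S] {D : Type u} [CStarAlgebra D]
  {H K L : Type u} [NormedAddCommGroup H] [InnerProductSpace ℂ H]
  [NormedAddCommGroup K] [InnerProductSpace ℂ K] [CompleteSpace K]
  [NormedAddCommGroup L] [InnerProductSpace ℂ L] [CompleteSpace L]
  {ι : S →ₗ[ℂ] (H →L[ℂ] H)}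

/-- If `U(S) ⊗_min D = U(S) ⊗_max D`, then the product of commuting unital completely positive maps
on `S` and `D` is completely contractive for the spatial norm. -/
theorem norm_matOp_dotMap_le [CompleteSpace H] (hι : IsCompleteOrderEmbedding ι)
    {ρ : D →⋆ₐ[ℂ] (K →L[ℂ] K)}
    (hρ : Function.Injective ρ)
    (hmax : ∀ (n : ℕ) (X : Matrix (Fin n) (Fin n) (upperAlgebra (LinearMap.range ι) ⊗[ℂ] D)),
      algMinNorm (A := upperAlgebra (LinearMap.range ι)) (Subalgebra.val _) ρ.toAlgHom X =
        algMaxNorm (A := upperAlgebra (LinearMap.range ι)) (Subalgebra.val _) ρ.toAlgHom X)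
    {φ : S →ₗ[ℂ] (L →L[ℂ] L)} {ψ : D →ₗ[ℂ] (L →L[ℂ] L)} (hφ : IsUCP φ) (hψ : IsUCP ψ)
    (hφψ : ∀ s d, Commute (φ s) (ψ d)) {n : ℕ} (X : Matrix (Fin n) (Fin n) (S ⊗[ℂ] D)) :
    ‖matOp (X.map (dotMap φ ψ))‖ ≤
      ‖matOp (X.map (spatialMap ι ρ.toAlgHom.toLinearMap))‖ := by
  let φ' := dilationLift hψ φ hφψ
  let π := dilationRep hψ
  let V := (dilationIsometry hψ).toContinuousLinearMap
  have hφ' : φ' OperatorSystem.unit = 1 := dilationLift_eq_one hψ φ hφψ hφ.1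
  -- Compressing by the Stinespring isometry recovers `φ · ψ` from the lifted pair.
  have hcompress : ∀ z, dotMap φ ψ z = ContinuousLinearMap.adjoint V ∘L
      dotMap φ' π.toAlgHom.toLinearMap z ∘L V := by
    intro z
    induction z with
    | zero => simp
    | add z w hz hw =>
      rw [map_add, map_add, ContinuousLinearMap.add_comp, ContinuousLinearMap.comp_add, hz, hw]
    | tmul s d =>
      ext η
      refine ext_inner_left ℂ fun ξ => ?_
      rw [ContinuousLinearMap.comp_apply, ContinuousLinearMap.adjoint_inner_right]
      exact (inner_dilationIsometry hψ φ hφψ s d ξ η).symm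
  have hV : ‖V‖ ≤ 1 := (dilationIsometry hψ).norm_toContinuousLinearMap_le
  have hV' : ‖ContinuousLinearMap.adjoint V‖ ≤ 1 := by
    rw [LinearIsometryEquiv.norm_map]
    exact hV
  have step1 : ‖matOp (X.map (dotMap φ ψ))‖ ≤
      ‖matOp (X.map (dotMap φ' π.toAlgHom.toLinearMap))‖ :=
    enorm_le_iff_norm_le.1 (enorm_matOp_map_le_of_eq_conj _ _ hV' hV hcompress X)
  -- The chain runs through the corner of `U(S) ⊗ D`: the lifted product is bounded by the maximal
  -- norm there, which equals the minimal norm by `hmax`, which is bounded by the spatial norm on `S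
  -- ⊗ D`.
  have step2 : ‖matOp (X.map (dotMap φ' π.toAlgHom.toLinearMap))‖ₑ ≤
      ‖matOp (X.map (spatialMap ι ρ.toAlgHom.toLinearMap))‖ₑ := by
    refine (enorm_matOp_dotMap_le_algMaxNorm (κ := upperCorner ι) (σ := upperRep hι φ' hφ')
      (isCompletelyContractive_upperRep hι φ' hφ' fun N Z =>
        (norm_matOp_dilationLift_le hψ φ hφψ Z).trans (hφ.norm_matOp_map_le hι Z))
      (fun T => ?_) (fun s => upperRep_eq hι hφ' (coe_upperCorner s))
      (commute_dilationLift_dilationRep hψ φ hφψ) hρ X).trans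
      ((hmax n _).ge.trans (algMinNorm_rTensor_corner_le coe_upperCorner ρ.toAlgHom X))
    obtain ⟨c, s, h⟩ := exists_eq_upperOp T
    exact ⟨c, s, upperRep_eq hι hφ' h⟩
  exact step1.trans (enorm_le_iff_norm_le.1 step2)

theorem spatialMap_one_tmul_one (hι : ι OperatorSystem.unit = 1) (ρ : D →⋆ₐ[ℂ] (K →L[ℂ] K)) :
    spatialMap ι ρ.toAlgHom.toLinearMap (OperatorSystem.unit ⊗ₜ 1) = 1 := by
  have h : ρ.toAlgHom.toLinearMap 1 = 1 := map_one ρ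
  rw [spatialMap_tmul, hι, h]
  ext x
  induction x using UniformSpace.Completion.induction_on with
  | hp => exact isClosed_eq (ContinuousLinearMap.continuous _) (ContinuousLinearMap.continuous _)
  | ih x =>
    have : TensorProduct.mapL (1 : H →L[ℂ] H) (1 : K →L[ℂ] K) = 1 := TensorProduct.mapL_id_id
    simp [this]

theorem matOp_map_add_smul_diagonal {V : Type u} [AddCommGroup V] [Module ℂ V]
    {E : Type u} [NormedAddCommGroup E] [InnerProductSpace ℂ E] (f : V →ₗ[ℂ] (E →L[ℂ] E)) {e : V}
    (he : f e = 1) {n : ℕ} (X : Matrix (Fin n) (Fin n) V) (z : ℂ) :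
    matOp ((X + z • Matrix.diagonal fun _ => e).map f) = matOp (X.map f) + z • 1 := by
  rw [← matOp_one, ← matOp_smul, ← matOp_add]
  congr 1
  ext1 i j
  by_cases h : i = j
  · subst h; simp [he]
  · simp [h]

theorem systemMinEqComm_of_algebraMinEqMax [CompleteSpace H] (hι : IsCompleteOrderEmbedding ι)
    (h : AlgebraMinEqMax (upperAlgebra (LinearMap.range ι)) D) : SystemMinEqComm S D := by
  obtain ⟨K, _, _, _, ρ, hρ, hmax⟩ := h
  refine fun n => Set.Subset.antisymm (fun X hX => ?_) (commCone_subset_minCone n)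
  intro L _ _ _ φ ψ hφ hψ hφψ
  refine isPositive_of_norm_add_smul_one_le
    (isPositive_matOp_spatialMap_of_mem_minCone hι.isUCP (isUCP_of_starAlgHom ρ) hX) fun z => ?_
  -- The norm estimate is applied to `X + z 1`; both `φ · ψ` and `ι ⊗ ρ` send `1 ⊗ 1` to the
  -- identity, so it becomes the shifted inequality required for positivity.
  have h1 := norm_matOp_dotMap_le hι hρ hmax hφ hψ hφψ
    (X + z • Matrix.diagonal fun _ => (OperatorSystem.unit : S) ⊗ₜ[ℂ] (1 : D))
  have h2 : dotMap φ ψ ((OperatorSystem.unit : S) ⊗ₜ[ℂ] (1 : D)) = 1 := by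
    have : ψ 1 = 1 := hψ.1
    rw [dotMap_tmul, hφ.1, this, one_mul]
  rwa [matOp_map_add_smul_diagonal _ h2,
    matOp_map_add_smul_diagonal _ (spatialMap_one_tmul_one hι.1 ρ)] at h1

end Main
end

theorem mainTheorem8 {S : Type u} [AddCommGroup S] [Module ℂ S] [StarAddMonoid S]
    [StarModule ℂ S] [OperatorSystem S]
    {H : Type u} [NormedAddCommGroup H] [InnerProductSpace ℂ H] [CompleteSpace H]
    (ι : S →ₗ[ℂ] (H →L[ℂ] H)) (hι : IsCompleteOrderEmbedding ι) :
    (∀ (D : Type u) [CStarAlgebra D],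
      AlgebraMinEqMax (upperAlgebra (LinearMap.range ι)) D → SystemMinEqComm S D) ∧
    (SystemDetectsNuclearity S →
      AlgebraDetectsNuclearity (upperAlgebra (LinearMap.range ι))) :=
  ⟨fun _ _ => systemMinEqComm_of_algebraMinEqMax hι,
    fun hS D _ hD => hS D (systemMinEqComm_of_algebraMinEqMax hι hD)⟩
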